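/- Let $N\ge 1$, let $\Omega\subset\mathbb R^N$ be a bounded domain (non-empty, open, connected) with $C^\infty$ boundary, let $\Gamma\subset\partial\Omega$ be either a relatively open subset of $\partial\Omega$ or a single point, and let $w:\mathbb R^N\to[0,\infty)$ be an $A_2$ weight (locally integrable, with $\left(\frac1{|K|}\int_K w\,dx\right)\left(\frac1{|K|}\int_K w^{-1}\,dx\right)\le c$ for all cubes $K\subset\mathbb R^N$ and some constant $c$) such that $w\in C(\overline\Omega)\cap C^\infty(\Omega)$, $w>0$ on $\Omega$ and $w=0$ on $\Gamma$. Let $H_0^1(\Omega;w)$ be the completion of $C_0^\infty(\Omega)$ in the norm $\|u\|_{H^1(\Omega;w)}=\left(\int_\Omega|\nabla u|^2w\,dx+\int_\Omega u^2\,dx\right)^{1/2}$, and assume that 1. there is $C>0$ with $\int_\Omega u^2\,dx\le C\int_\Omega|\nabla u|^2w\,dx$ for all $u\in H_0^1(\Omega;w)$; 2. the embedding $H_0^1(\Omega;w)\hookrightarrow W^{1,1}(\Omega)$ is continuous; 3. the embedding $H_0^1(\Omega;w)\hookrightarrow L^2(\Omega)$ is compact. Let $\mathcal A u=\operatorname{div}(w\nabla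 u)$, as an operator in $L^2(\Omega)$ whose domain consists of the $u\in H_0^1(\Omega;w)$ with $\operatorname{div}(w\nabla u)\in L^2(\Omega)$ in the weak sense, i.e. $\int_\Omega \nabla u\cdot\nabla\psi\,w\,dx=-\int_\Omega(\mathcal Au)\,\psi\,dx$ for all $\psi\in C_0^\infty(\Omega)$. For real-valued $\rho\in L^\infty(\Omega)$, a number $\lambda\in\mathbb R$ is an eigenvalue of $\mathcal A+\rho$ if $\ker(\mathcal A+\rho+\lambda)\ne\{0\}$, and it is simple if this kernel is one-dimensional. For $n\ge 0$ let $A_n$ be the set of all $\rho\in L^\infty(\Omega)$ for which the first $n$ eigenvalues of $\mathcal A+\rho$ are simple; that is, $\mathcal A+\rho$ has simple eigenvalues $\lambda_1<\dots<\lambda_n$, and every other eigenvalue is larger than each of these. In particular $A_0=L^\infty(\Omega)$. **Theorem.** For every $n\in\mathbb N$, $n\ge1$, the set $A_n$ is contained in $A_{n-1}$ and is dense in $A_{n-1}$ with respect to the norm of $L^\infty(\Omega)$. -/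

import Mathlib

open MeasureTheory Set TopologicalSpace
open scoped ENNReal NNReal ContDiff Distributions Gradient RealInnerProductSpace

namespace DegenerateElliptic

/-- Euclidean space `ℝ^N`. -/
abbrev Euc (N : ℕ) : Type := EuclideanSpace ℝ (Fin N)

/-- The closed axis-parallel cube with lower corner `a` and side length `l`. -/
def cube {N : ℕ} (a : Euc N) (l : ℝ) : Set (Euc N) :=
  {x | ∀ i, a i ≤ x i ∧ x i ≤ a i + l}

/-- `w` is an `A₂` weight on `ℝ^N`: it is non-negative, locally integrable, and the averages
of `w` and of `w⁻¹` over cubes have uniformly bounded product. The averages are computed in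
`[0, ∞]`, so that the bound forces `w⁻¹` to be integrable on cubes where `w` does not vanish
almost everywhere. -/
structure IsA2Weight {N : ℕ} (w : Euc N → ℝ) : Prop where
  nonneg : ∀ x, 0 ≤ w x
  locallyIntegrable : LocallyIntegrable w volume
  bound : ∃ c : ℝ≥0, ∀ (a : Euc N) (l : ℝ), 0 < l →
    ((volume (cube a l))⁻¹ * ∫⁻ x in cube a l, ENNReal.ofReal (w x)) *
      ((volume (cube a l))⁻¹ * ∫⁻ x in cube a l, (ENNReal.ofReal (w x))⁻¹) ≤ c

/-- The boundary of `Ω` is of class `C^∞`: near each boundary point, `Ω` is the set where a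
smooth function with non-vanishing differential is negative. -/
def HasSmoothBoundary {N : ℕ} (Ω : Opens (Euc N)) : Prop :=
  ∀ x ∈ frontier (Ω : Set (Euc N)), ∃ U : Set (Euc N), IsOpen U ∧ x ∈ U ∧
    ∃ φ : Euc N → ℝ, ContDiffOn ℝ ∞ φ U ∧ fderiv ℝ φ x ≠ 0 ∧
      (Ω : Set (Euc N)) ∩ U = {y | y ∈ U ∧ φ y < 0}

/-- Lebesgue measure `dx` on `Ω`. -/
noncomputable abbrev dom {N : ℕ} (Ω : Opens (Euc N)) : Measure (Euc N) :=
  volume.restrict (Ω : Set (Euc N))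

/-- The weighted measure `w dx` on `Ω`. -/
noncomputable abbrev wdom {N : ℕ} (Ω : Opens (Euc N)) (w : Euc N → ℝ) : Measure (Euc N) :=
  (dom Ω).withDensity (fun x => ENNReal.ofReal (w x))

/-- `L²(Ω)`. -/
abbrev L2 {N : ℕ} (Ω : Opens (Euc N)) : Type := Lp ℝ 2 (dom Ω)

/-- `L^∞(Ω)`, with its norm topology. -/
abbrev LInf {N : ℕ} (Ω : Opens (Euc N)) : Type := Lp ℝ ∞ (dom Ω)

/-- The Hilbert space `L²(Ω; dx) × L²(Ω; w dx)^N` of pairs `(u, G)`, with the norm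
`(∫ u² dx + ∫ |G|² w dx)^{1/2}`. A function `u` with (weak) gradient `∇u` is represented by
the pair `(u, ∇u)`, so that this is the norm of `H¹(Ω; w)`. -/
abbrev Pairs {N : ℕ} (Ω : Opens (Euc N)) (w : Euc N → ℝ) : Type :=
  WithLp 2 (L2 Ω × Lp (Euc N) 2 (wdom Ω w))

theorem gradient_testFunction_add {N : ℕ} {Ω : Opens (Euc N)} (φ ψ : 𝓓(Ω, ℝ)) :
    (∇ (φ + ψ : 𝓓(Ω, ℝ))) = (∇ φ) + (∇ ψ) := by
  funext x
  have h1 : DifferentiableAt ℝ φ x := (φ.contDiff.differentiable (by simp)) x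
  have h2 : DifferentiableAt ℝ ψ x := (ψ.contDiff.differentiable (by simp)) x
  change (InnerProductSpace.toDual ℝ _).symm (fderiv ℝ ((φ : Euc N → ℝ) + (ψ : Euc N → ℝ)) x) = _
  rw [fderiv_add h1 h2, map_add]
  rfl

theorem gradient_testFunction_smul {N : ℕ} {Ω : Opens (Euc N)} (c : ℝ) (φ : 𝓓(Ω, ℝ)) :
    (∇ (c • φ : 𝓓(Ω, ℝ))) = c • (∇ φ) := by
  funext x
  have h1 : DifferentiableAt ℝ φ x := (φ.contDiff.differentiable (by simp)) x
  change (InnerProductSpace.toDual ℝ _).symm (fderiv ℝ (c • (φ : Euc N → ℝ)) x) = _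
  rw [fderiv_const_smul h1, map_smulₛₗ]
  rfl

/-- The pairs `(φ, ∇φ)` with `φ ∈ C₀^∞(Ω)`. -/
def testPairs {N : ℕ} (Ω : Opens (Euc N)) (w : Euc N → ℝ) : Submodule ℝ (Pairs Ω w) where
  carrier := {q | ∃ φ : 𝓓(Ω, ℝ), q.fst =ᵐ[dom Ω] φ ∧ q.snd =ᵐ[wdom Ω w] (∇ φ)}
  zero_mem' := by
    refine ⟨0, Lp.coeFn_zero _ _ _, ?_⟩
    have h : (∇ (0 : 𝓓(Ω, ℝ))) = (0 : Euc N → Euc N) := by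
      simpa using gradient_testFunction_smul (0 : ℝ) (0 : 𝓓(Ω, ℝ))
    rw [h]
    exact Lp.coeFn_zero _ _ _
  add_mem' := by
    rintro p q ⟨φ, h1, h2⟩ ⟨ψ, h3, h4⟩
    refine ⟨φ + ψ, (Lp.coeFn_add p.fst q.fst).trans (h1.add h3), ?_⟩
    rw [gradient_testFunction_add]
    exact (Lp.coeFn_add p.snd q.snd).trans (h2.add h4)
  smul_mem' := by
    rintro c p ⟨φ, h1, h2⟩
    refine ⟨c • φ, (Lp.coeFn_smul c p.fst).trans (h1.const_smul c), ?_⟩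
    rw [gradient_testFunction_smul]
    exact (Lp.coeFn_smul c p.snd).trans (h2.const_smul c)

/-- `H₀¹(Ω; w)`, the completion of `C₀^∞(Ω)` in the norm of `H¹(Ω; w)`: the closure of the
pairs `(φ, ∇φ)`. Its elements are the pairs `(u, ∇u)` with `u ∈ H₀¹(Ω; w)`. -/
noncomputable def H01 {N : ℕ} (Ω : Opens (Euc N)) (w : Euc N → ℝ) : Submodule ℝ (Pairs Ω w) :=
  (testPairs Ω w).topologicalClosure

/-- The graph of `𝒜 u = div (w ∇u)` with domain `H₀¹(Ω; w) ∩ H²(Ω; w)`: the pairs `(u, f)`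
in `L²(Ω) × L²(Ω)` such that `u ∈ H₀¹(Ω; w)` and `div (w ∇u) = f` weakly, that is,
`∫ ∇u · ∇ψ w dx = - ∫ f ψ dx` for all `ψ ∈ C₀^∞(Ω)`. The two integrals are written as
inner products of `L²(Ω; w dx)^N` and of `L²(Ω)`. -/
def graphA {N : ℕ} (Ω : Opens (Euc N)) (w : Euc N → ℝ) : Submodule ℝ (L2 Ω × L2 Ω) where
  carrier := {z | ∃ p ∈ H01 Ω w, p.fst = z.1 ∧
    ∀ q ∈ testPairs Ω w, ⟪p.snd, q.snd⟫ = - ⟪z.2, q.fst⟫}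
  zero_mem' := ⟨0, Submodule.zero_mem _, rfl, fun q _ => by simp⟩
  add_mem' := by
    rintro z z' ⟨p, hp, h1, h2⟩ ⟨p', hp', h1', h2'⟩
    refine ⟨p + p', Submodule.add_mem _ hp hp', by simp [h1, h1'], fun q hq => ?_⟩
    simp only [WithLp.add_snd, Prod.snd_add, inner_add_left, h2 q hq, h2' q hq]
    ring
  smul_mem' := by
    rintro c z ⟨p, hp, h1, h2⟩
    refine ⟨c • p, Submodule.smul_mem _ c hp, by simp [h1], fun q hq => ?_⟩
    simp only [WithLp.smul_snd, Prod.smul_snd, real_inner_smul_left, h2 q hq]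
    ring

/-- The eigenspace `ker (𝒜 + ρ + μ)`, that is, the `u` in the domain of `𝒜` with
`𝒜 u = - (ρ u + μ u)`, where `ρ u` is the pointwise product. -/
noncomputable def eigenspace {N : ℕ} (Ω : Opens (Euc N)) (w : Euc N → ℝ) (ρ : LInf Ω) (μ : ℝ) :
    Submodule ℝ (L2 Ω) where
  carrier := {u | (u, -((ρ • u : L2 Ω) + μ • u)) ∈ graphA Ω w}
  zero_mem' := by
    have h : (ρ • (0 : L2 Ω) : L2 Ω) = 0 := Lp.smul_zero ℝ 2 ρ
    simp only [mem_ofPred_eq, h, smul_zero, add_zero, neg_zero]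
    exact Submodule.zero_mem _
  add_mem' := by
    intro u v hu hv
    have h : (ρ • (u + v) : L2 Ω) = ρ • u + ρ • v := Lp.add_smul ρ u v
    have e : ((u + v, -((ρ • (u + v) : L2 Ω) + μ • (u + v))) : L2 Ω × L2 Ω) =
        (u, -((ρ • u : L2 Ω) + μ • u)) + (v, -((ρ • v : L2 Ω) + μ • v)) := by
      rw [h, smul_add, Prod.mk_add_mk]
      congr 1
      abel
    rw [mem_ofPred_eq, e]
    exact Submodule.add_mem _ hu hv
  smul_mem' := by
    intro c u hu
    have h : (ρ • (c • u) : L2 Ω) = c • (ρ • u : L2 Ω) := (Lp.smul_comm c ρ u).symm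
    have e : ((c • u, -((ρ • (c • u) : L2 Ω) + μ • (c • u))) : L2 Ω × L2 Ω) =
        c • (u, -((ρ • u : L2 Ω) + μ • u)) := by
      rw [h, smul_comm μ c u, Prod.smul_mk, smul_neg, smul_add]
    rw [mem_ofPred_eq, e]
    exact Submodule.smul_mem _ c hu

/-- `μ` is an eigenvalue of `𝒜 + ρ`: `ker (𝒜 + ρ + μ) ≠ {0}`. -/
def IsEigenvalue {N : ℕ} (Ω : Opens (Euc N)) (w : Euc N → ℝ) (ρ : LInf Ω) (μ : ℝ) : Prop :=
  eigenspace Ω w ρ μ ≠ ⊥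

/-- The set `A_n` of all `ρ ∈ L^∞(Ω)` such that the first `n` eigenvalues of `𝒜 + ρ` are
simple: `𝒜 + ρ` has eigenvalues `λ_1 < ⋯ < λ_n`, each with a one-dimensional eigenspace, and
every other eigenvalue is larger than all of these. -/
def simpleSet {N : ℕ} (Ω : Opens (Euc N)) (w : Euc N → ℝ) (n : ℕ) : Set (LInf Ω) :=
  {ρ | ∃ ev : Fin n → ℝ, StrictMono ev ∧
    (∀ i, Module.finrank ℝ (eigenspace Ω w ρ (ev i)) = 1) ∧
    ∀ μ, IsEigenvalue Ω w ρ μ → μ ∈ range ev ∨ ∀ i, ev i < μ}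

/-- The standing assumptions on the bounded smooth domain `Ω`, the set `Γ ⊆ ∂Ω` and the
weight `w`. -/
structure Admissible {N : ℕ} (Ω : Opens (Euc N)) (Γ : Set (Euc N)) (w : Euc N → ℝ) : Prop where
  isConnected : IsConnected (Ω : Set (Euc N))
  isBounded : Bornology.IsBounded (Ω : Set (Euc N))
  hasSmoothBoundary : HasSmoothBoundary Ω
  /-- `Γ` is a relatively open subset of `∂Ω` or a single point of `∂Ω`. -/
  boundarySet : (∃ V : Set (Euc N), IsOpen V ∧ Γ = frontier (Ω : Set (Euc N)) ∩ V) ∨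
    ∃ x₀ ∈ frontier (Ω : Set (Euc N)), Γ = {x₀}
  isA2Weight : IsA2Weight w
  continuousOn : ContinuousOn w (closure (Ω : Set (Euc N)))
  contDiffOn : ContDiffOn ℝ ∞ w (Ω : Set (Euc N))
  pos : ∀ x ∈ Ω, 0 < w x
  zero : ∀ x ∈ Γ, w x = 0
  /-- The Poincaré inequality `∫ u² dx ≤ C ∫ |∇u|² w dx` on `H₀¹(Ω; w)`. -/
  poincare : ∃ C : ℝ, ∀ p ∈ H01 Ω w, ‖p.fst‖ ^ 2 ≤ C * ‖p.snd‖ ^ 2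
  /-- The embedding of `H₀¹(Ω; w)` into `W^{1,1}(Ω)` is continuous. -/
  embedding : ∃ C : ℝ≥0, ∀ p ∈ H01 Ω w,
    eLpNorm p.fst 1 (dom Ω) + eLpNorm p.snd 1 (dom Ω) ≤ ENNReal.ofReal (C * ‖p‖)
  /-- The embedding of `H₀¹(Ω; w)` into `L²(Ω)` is compact. -/
  compact : IsCompactOperator (fun p : H01 Ω w => (p : Pairs Ω w).fst)

end DegenerateElliptic

/-!
### Generic simplicity of the first eigenvalues

Let `J : H₀¹(Ω; w) → L²(Ω)` be the embedding. For `s > 1 + ‖ρ‖` the form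
`∫ |∇u|² w + ∫ (s - ρ) u²` is coercive on `H₀¹(Ω; w)`, so `s - 𝒜 - ρ` has a bounded inverse
`K ρ = J G J†` on `L²(Ω)`, where `G` inverts the operator representing the form
(`formResolvent`). It is compact, symmetric and positive, it depends continuously on `ρ`, and
`K ρ - K τ = K ρ (ρ - τ) K τ`. The numbers `μ` with `ker (𝒜 + ρ + μ) ≠ 0` are the `κ⁻¹ - s` with
`κ` an eigenvalue of `K ρ`, with the same eigenspaces (`exists_adjoint_eq_iff`). Hence `A_n` is the
set of those `ρ` for which, for each `k ≤ n`, exactly `k` eigenvalues of `K ρ`, counted with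
multiplicity, lie above a suitable positive threshold (`Admissible.mem_simpleSet_iff`). In this
form the inclusion `A_n ⊆ A_{n-1}` is clear.

For a threshold outside the spectrum that number is locally constant in `ρ`
(`EigenBasis.ncard_upper_eq`), so the condition is open. Among all parameters of `A_n` in a small
ball and all thresholds with at least `n + 1` eigenvalues above them, take one with the least
number `d` of such eigenvalues. If `d = n + 1`, the parameter lies in `A_{n+1}`. Otherwise
minimality forces the last `d - n ≥ 2` of them to coincide for all nearby parameters
(`ResolventFamily.exists_hasSimpleTop_or_rigid`): there is a multiple eigenvalue that no small
perturbation splits. Perturbing by `t σ`, pairing an eigenvector `p` at `t = 0` with an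
eigenvector `q_t → q` at `t` through the resolvent identity, and letting `t → 0`, one gets that
`∫ σ p q` is a multiple of `∫ p q` that does not depend on `p` and `q`
(`ResolventFamily.inner_eq_of_rigid`). For orthonormal eigenfunctions `u` and `v` this gives
`∫ σ u v = 0` and `∫ σ u² = ∫ σ v²` for every bounded `σ`, so that `u v = 0` and `u² = v²` almost
everywhere, whence `u = 0` (`eq_zero_of_forall_inner_mulOp`), a contradiction.
-/

namespace DegenerateElliptic

open Module Filter Topology ContinuousLinearMap
open scoped InnerProduct

universe u

variable {H : Type u} [NormedAddCommGroup H] [InnerProductSpace ℝ H]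

/-! ### Eigenbases of compact symmetric operators -/

/-- A Hilbert basis of eigenvectors of the symmetric operator `K`. -/
structure EigenBasis (K : H →L[ℝ] H) where
  /-- The index type of the basis. -/
  ι : Type u
  /-- The basis. -/
  basis : HilbertBasis ι ℝ H
  /-- The eigenvalue of each basis vector. -/
  val : ι → ℝ
  apply_basis : ∀ i, K (basis i) = val i • basis i
  isSymmetric : (K : H →ₗ[ℝ] H).IsSymmetric

theorem isClosed_eigenspace (K : H →L[ℝ] H) (κ : ℝ) :
    IsClosed (End.eigenspace (K : End ℝ H) κ : Set H) := by
  have : (End.eigenspace (K : End ℝ H) κ : Set H) = {x | K x = κ • x} := by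
    ext x
    simp
  rw [this]
  exact isClosed_eq K.continuous (continuous_const_smul κ)

/-- The spectral theorem, with Hilbert bases of the eigenspaces collected into one. -/
theorem exists_eigenBasis [CompleteSpace H] {K : H →L[ℝ] H} (hc : IsCompactOperator K)
    (hs : (K : H →ₗ[ℝ] H).IsSymmetric) : Nonempty (EigenBasis K) := by
  have hcomplete : ∀ κ : ℝ, CompleteSpace (End.eigenspace (K : End ℝ H) κ) :=
    fun κ => (isClosed_eigenspace K κ).completeSpace_coe
  choose I c hcoe using fun κ : ℝ => exists_hilbertBasis ℝ (End.eigenspace (K : End ℝ H) κ)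
  let v : (Σ κ : ℝ, I κ) → H := fun i => (c i.1 i.2 : H)
  have hv : Orthonormal ℝ v :=
    hs.orthogonalFamily_eigenspaces.orthonormal_sigma_orthonormal
      (v_family := fun κ => (c κ : I κ → _)) (fun κ => (c κ).orthonormal)
  have hsp : (Submodule.span ℝ (range v))ᗮ = ⊥ := by
    rw [eq_bot_iff, ← ContinuousLinearMap.orthogonalComplement_iSup_eigenspaces_eq_bot hc hs,
      ← Submodule.iInf_orthogonal]
    intro x hx
    rw [Submodule.mem_iInf]
    intro κ
    rw [Submodule.mem_orthogonal']
    intro y hy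
    have h1 := ((c κ).hasSum_repr ⟨y, hy⟩).mapL
      ((innerSL ℝ x).comp (End.eigenspace (K : End ℝ H) κ).subtypeL)
    have h2 : ∀ i, ⟪x, (c κ i : H)⟫ = 0 := fun i =>
      (Submodule.mem_orthogonal' _ _).1 hx _ (Submodule.subset_span ⟨⟨κ, i⟩, rfl⟩)
    have h3 : HasSum (fun _ : I κ => (0 : ℝ)) ⟪x, y⟫ := by
      simpa [real_inner_smul_right, h2] using h1
    exact h3.unique hasSum_zero
  refine ⟨⟨(Σ κ : ℝ, I κ), HilbertBasis.mkOfOrthogonalEqBot hv hsp, fun i => i.1, ?_, hs⟩⟩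
  intro i
  rw [HilbertBasis.coe_mkOfOrthogonalEqBot]
  exact End.mem_eigenspace_iff.1 (c i.1 i.2).2

namespace EigenBasis

variable {K L : H →L[ℝ] H} (B : EigenBasis K)

theorem inner_basis_apply (i : B.ι) (x : H) :
    ⟪B.basis i, K x⟫ = B.val i * ⟪B.basis i, x⟫ := by
  have := B.isSymmetric (B.basis i) x
  simp only [ContinuousLinearMap.coe_coe] at this
  rw [← this, B.apply_basis, real_inner_smul_left]

theorem hasSum_sq (x : H) : HasSum (fun i => ⟪B.basis i, x⟫ ^ 2) (‖x‖ ^ 2) := by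
  have := B.basis.hasSum_inner_mul_inner x x
  rw [real_inner_self_eq_norm_sq] at this
  simpa [sq, real_inner_comm] using this

theorem hasSum_inner_apply (x : H) :
    HasSum (fun i => B.val i * ⟪B.basis i, x⟫ ^ 2) ⟪K x, x⟫ := by
  have := B.basis.hasSum_inner_mul_inner x (K x)
  rw [real_inner_comm] at this
  convert! this using 2 with i
  rw [B.inner_basis_apply, real_inner_comm]
  ring

theorem mul_norm_sq_le {a : ℝ} {x : H} (h : ∀ i, ⟪B.basis i, x⟫ ≠ 0 → a ≤ B.val i) :
    a * ‖x‖ ^ 2 ≤ ⟪K x, x⟫ := by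
  refine hasSum_le (fun i => ?_) ((B.hasSum_sq x).mul_left a) (B.hasSum_inner_apply x)
  by_cases hi : ⟪B.basis i, x⟫ = 0
  · simp [hi]
  · exact mul_le_mul_of_nonneg_right (h i hi) (sq_nonneg _)

theorem le_mul_norm_sq {a : ℝ} {x : H} (h : ∀ i, ⟪B.basis i, x⟫ ≠ 0 → B.val i ≤ a) :
    ⟪K x, x⟫ ≤ a * ‖x‖ ^ 2 := by
  refine hasSum_le (fun i => ?_) (B.hasSum_inner_apply x) ((B.hasSum_sq x).mul_left a)
  by_cases hi : ⟪B.basis i, x⟫ = 0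
  · simp [hi]
  · exact mul_le_mul_of_nonneg_right (h i hi) (sq_nonneg _)

theorem inner_basis_eq_zero {κ : ℝ} {x : H} (hx : K x = κ • x) {i : B.ι} (hi : B.val i ≠ κ) :
    ⟪B.basis i, x⟫ = 0 := by
  have h := B.inner_basis_apply i x
  rw [hx, real_inner_smul_right] at h
  exact (mul_eq_zero.1 (by linear_combination h : (κ - B.val i) * ⟪B.basis i, x⟫ = 0)).resolve_left
    (sub_ne_zero.2 hi.symm)

/-- Every eigenvalue occurs in the basis. -/
theorem exists_val_eq {κ : ℝ} {x : H} (hx : K x = κ • x) (h0 : x ≠ 0) : ∃ i, B.val i = κ := by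
  by_contra! h
  have h1 : HasSum (fun _ : B.ι => (0 : ℝ)) (‖x‖ ^ 2) := by
    simpa [B.inner_basis_eq_zero hx (h _)] using B.hasSum_sq x
  have := h1.unique hasSum_zero
  simp [h0] at this

/-- The indices of the eigenvalues that are at least `a`. -/
def upper (a : ℝ) : Set B.ι := {i | a ≤ B.val i}

theorem upper_anti {a b : ℝ} (h : a ≤ b) : B.upper b ⊆ B.upper a := fun _ hi => h.trans hi

/-- An infinite orthonormal sequence of eigenvectors with eigenvalues at least `a > 0` would have
an image without convergent subsequences. -/
theorem finite_upper (hc : IsCompactOperator K) {a : ℝ} (ha : 0 < a) : (B.upper a).Finite := by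
  by_contra hinf
  have hinf' : (B.upper a).Infinite := hinf
  let e := hinf'.natEmbedding
  have hb : ∀ n, ‖B.basis (e n)‖ = 1 := fun n => B.basis.orthonormal.1 _
  obtain ⟨x, -, φ, hφ, hlim⟩ := (IsCompactOperator.isCompact_closure_image_closedBall
    (f := (K : H →ₗ[ℝ] H)) hc 1).tendsto_subseq
    (x := fun n => K (B.basis (e n))) (fun n => subset_closure ⟨_, by simp [hb], rfl⟩)
  obtain ⟨n, hn⟩ := Metric.cauchySeq_iff.1 hlim.cauchySeq a ha
  have h1 := hn n le_rfl (n + 1) (Nat.le_succ n)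
  have hne : (e (φ n) : B.ι) ≠ e (φ (n + 1)) := fun h =>
    (hφ (Nat.lt_succ_self n)).ne (e.injective (Subtype.val_injective h))
  have h2 : ⟪B.basis (e (φ n)), K (B.basis (e (φ n))) - K (B.basis (e (φ (n + 1))))⟫ =
      B.val (e (φ n)) := by
    rw [inner_sub_right, B.inner_basis_apply, B.inner_basis_apply, B.basis.orthonormal.2 hne,
      real_inner_self_eq_norm_sq, hb]
    ring
  have h3 := real_inner_le_norm (B.basis (e (φ n)))
    (K (B.basis (e (φ n))) - K (B.basis (e (φ (n + 1)))))
  rw [h2, hb, one_mul, ← dist_eq_norm] at h3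
  have h4 : a ≤ B.val (e (φ n)) := (e (φ n)).2
  exact absurd (h4.trans h3) (not_le.2 h1)

/-- A nonzero combination of the eigenvectors of `K` above `α` cannot be orthogonal to all
eigenvectors of `L` above `β`, as can be seen by comparing the two quadratic forms on it. -/
theorem ncard_upper_le {B : EigenBasis K} {B' : EigenBasis L} {α β : ℝ}
    (hKL : ‖K - L‖ < α - β) (hB : (B.upper α).Finite) (hB' : (B'.upper β).Finite) :
    (B.upper α).ncard ≤ (B'.upper β).ncard := by
  by_contra! hlt
  have := hB.fintype
  have := hB'.fintype
  let f : (B.upper α → ℝ) →ₗ[ℝ] H := Fintype.linearCombination ℝ (fun i : B.upper α => B.basis i)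
  let g : H →ₗ[ℝ] (B'.upper β → ℝ) := LinearMap.pi fun j => (innerₗ H) (B'.basis j)
  have hker : LinearMap.ker (g ∘ₗ f) ≠ ⊥ := by
    apply LinearMap.ker_ne_bot_of_finrank_lt
    rw [Module.finrank_fintype_fun_eq_card, Module.finrank_fintype_fun_eq_card,
      ← Nat.card_eq_fintype_card, ← Nat.card_eq_fintype_card]
    exact hlt
  obtain ⟨c, hc, hc0⟩ := Submodule.exists_mem_ne_zero_of_ne_bot hker
  have horth : Orthonormal ℝ (fun i : B.upper α => B.basis i) :=
    B.basis.orthonormal.comp _ Subtype.val_injective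
  have hfc : f c ≠ 0 := by
    intro h0
    apply hc0
    have := horth.linearIndependent
    rw [Fintype.linearIndependent_iff] at this
    exact funext (this c h0)
  have h1 : α * ‖f c‖ ^ 2 ≤ ⟪K (f c), f c⟫ := by
    refine B.mul_norm_sq_le fun i hi => ?_
    by_contra hlt'
    apply hi
    simp only [f, Fintype.linearCombination_apply, inner_sum, real_inner_smul_right]
    refine Finset.sum_eq_zero fun j _ => ?_
    have : i ≠ j := by
      rintro rfl
      exact hlt' j.2
    rw [B.basis.orthonormal.2 this, mul_zero]
  have h2 : ⟪L (f c), f c⟫ ≤ β * ‖f c‖ ^ 2 := by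
    refine B'.le_mul_norm_sq fun i hi => ?_
    by_contra! hlt'
    exact hi (congrFun (LinearMap.mem_ker.1 hc) ⟨i, hlt'.le⟩)
  have h3 : ⟪(K - L) (f c), f c⟫ ≤ ‖K - L‖ * ‖f c‖ ^ 2 := by
    calc _ ≤ ‖(K - L) (f c)‖ * ‖f c‖ := real_inner_le_norm _ _
      _ ≤ ‖K - L‖ * ‖f c‖ * ‖f c‖ := by gcongr; exact (K - L).le_opNorm _
      _ = _ := by ring
  have h4 : 0 < ‖f c‖ ^ 2 := by positivity
  rw [_root_.sub_apply, inner_sub_left] at h3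
  nlinarith

/-- A threshold can be lowered slightly, without changing the number of eigenvalues above it, to
one that stays away from all eigenvalues. -/
theorem exists_gap (hc : IsCompactOperator K) {a : ℝ} (ha : 0 < a) :
    ∃ a' δ, 0 < δ ∧ δ < a' ∧ B.upper a' = B.upper a ∧
      ∀ i, B.val i < a' - δ ∨ a' + δ < B.val i := by
  have hfin := B.finite_upper hc (half_pos ha)
  let S : Set ℝ := insert (a / 2) (B.val '' (B.upper (a / 2)) ∩ Iio a)
  have hS : S.Finite := ((hfin.image _).inter_of_left _).insert _
  obtain ⟨m, hm, hmax⟩ := Set.exists_max_image S id hS ⟨a / 2, mem_insert _ _⟩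
  have hma : m < a := by
    rcases hm with rfl | hm
    · linarith
    · exact hm.2
  have hm2 : a / 2 ≤ m := hmax _ (mem_insert _ _)
  have key : ∀ i, B.val i ≤ m ∨ a ≤ B.val i := by
    intro i
    by_contra! hi
    exact absurd (hmax (B.val i) (mem_insert_of_mem _ ⟨⟨i, hm2.trans hi.1.le, rfl⟩, hi.2⟩))
      (not_le.2 hi.1)
  refine ⟨(m + a) / 2, (a - m) / 4, by linarith, by linarith, ?_, fun i => ?_⟩
  · ext i
    simp only [upper, mem_ofPred_eq]
    rcases key i with h | h <;> constructor <;> intro <;> linarith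
  · rcases key i with h | h
    · left; linarith
    · right; linarith

/-- The number of eigenvalues above `a` does not change under perturbations that are smaller than
the distance of `a` to the spectrum. -/
theorem ncard_upper_eq {B : EigenBasis K} {B' : EigenBasis L} {a δ : ℝ} (hK : IsCompactOperator K)
    (hL : IsCompactOperator L) (hδ : 0 < δ) (hδa : δ < a)
    (hgap : ∀ i, B.val i < a - δ ∨ a + δ < B.val i) (hKL : ‖K - L‖ < δ) :
    (B'.upper a).ncard = (B.upper a).ncard := by
  have h1 : B.upper (a + δ) = B.upper a := by
    ext i
    simp only [upper, mem_ofPred_eq]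
    rcases hgap i with h | h <;> constructor <;> intro <;> linarith
  have h2 : B.upper (a - δ) = B.upper a := by
    ext i
    simp only [upper, mem_ofPred_eq]
    rcases hgap i with h | h <;> constructor <;> intro <;> linarith
  apply le_antisymm
  · obtain ⟨η, hη, hη'⟩ := exists_between hKL
    have h3 : B.upper (a - η) = B.upper a :=
      ((B.upper_anti (by linarith)).trans h2.subset).antisymm
        (B.upper_anti (by linarith [norm_nonneg (K - L)]))
    rw [← h3]
    exact ncard_upper_le (by rw [norm_sub_rev]; linarith) (B'.finite_upper hL (by linarith))
      (B.finite_upper hK (by linarith))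
  · rw [← h1]
    exact ncard_upper_le (by linarith) (B.finite_upper hK (by linarith))
      (B'.finite_upper hL (by linarith))

/-- If the spectrum of `K` near `κ₀` is at most the single eigenvalue `κ`, then an approximate
eigenvector for `κ₀` is close to the eigenspace of `κ`. -/
theorem exists_eigenvector_near [CompleteSpace H] {κ κ₀ δ : ℝ} (hδ : 0 < δ)
    (h : ∀ i, B.val i ≠ κ → δ ≤ |B.val i - κ₀|) (x : H) :
    ∃ v, K v = κ • v ∧ δ * ‖x - v‖ ≤ ‖K x - κ₀ • x‖ := by
  have := (isClosed_eigenspace K κ).completeSpace_coe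
  let E := End.eigenspace (K : End ℝ H) κ
  -- `v` is the orthogonal projection of `x` to the eigenspace.
  let v := E.starProjection x
  have hv : K v = κ • v := End.mem_eigenspace_iff.1 (E.starProjection_apply_mem x)
  refine ⟨v, hv, ?_⟩
  have h1 := (B.hasSum_sq (x - v)).mul_left (δ ^ 2)
  have h2 := B.hasSum_sq (K x - κ₀ • x)
  have h3 : δ ^ 2 * ‖x - v‖ ^ 2 ≤ ‖K x - κ₀ • x‖ ^ 2 := by
    refine hasSum_le (fun i => ?_) h1 h2
    rw [inner_sub_right _ (K x), B.inner_basis_apply, real_inner_smul_right, inner_sub_right]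
    by_cases hi : B.val i = κ
    · have : ⟪B.basis i, x - v⟫ = 0 := by
        refine Submodule.sub_starProjection_mem_orthogonal (K := E) x _ ?_
        rw [End.mem_eigenspace_iff, ← hi]
        exact B.apply_basis i
      rw [inner_sub_right] at this
      rw [this]
      nlinarith [sq_nonneg (B.val i * ⟪B.basis i, x⟫ - κ₀ * ⟪B.basis i, x⟫)]
    · rw [B.inner_basis_eq_zero hv hi, sub_zero, ← sub_mul, mul_pow]
      refine mul_le_mul_of_nonneg_right ?_ (sq_nonneg _)
      rw [← sq_abs (B.val i - κ₀)]
      exact pow_le_pow_left₀ hδ.le (h i hi) 2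
  rw [← mul_pow] at h3
  exact le_of_sq_le_sq h3 (norm_nonneg _)

end EigenBasis

/-! ### Families of resolvents and splitting of multiple eigenvalues -/

/-- The `n` largest eigenvalues are simple: for each `k ≤ n`, some positive threshold has exactly
`k` eigenvalues above it, counted with multiplicity. -/
def EigenBasis.HasSimpleTop {K : H →L[ℝ] H} (B : EigenBasis K) (n : ℕ) : Prop :=
  ∀ k ≤ n, ∃ a, 0 < a ∧ (B.upper a).ncard = k

variable {X : Type*} [NormedAddCommGroup X] [NormedSpace ℝ X]

/-- `K x = (T - M x)⁻¹`, for `x` in the open set `U`, are compact positive resolvents of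
perturbations by the bounded symmetric operators `M x` of one operator `T`. The operator `T`
itself enters only through the resolvent identity. -/
structure ResolventFamily (M : X →ₗ[ℝ] H →L[ℝ] H) (U : Set X) (K : X → H →L[ℝ] H) : Prop where
  isOpen : IsOpen U
  continuousOn : ContinuousOn K U
  isSymmetric : ∀ x ∈ U, (K x : H →ₗ[ℝ] H).IsSymmetric
  isCompactOperator : ∀ x ∈ U, IsCompactOperator (K x)
  pos : ∀ x ∈ U, ∀ u, u ≠ 0 → 0 < ⟪K x u, u⟫
  resolvent : ∀ x ∈ U, ∀ y ∈ U, ∀ u, K x u - K y u = K x (M (x - y) (K y u))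

namespace ResolventFamily

variable {M : X →ₗ[ℝ] H →L[ℝ] H} {U : Set X} {K : X → H →L[ℝ] H}

theorem val_pos (hF : ResolventFamily M U K) {x : X} (hx : x ∈ U) (B : EigenBasis (K x))
    (i : B.ι) : 0 < B.val i := by
  have h := hF.pos x hx (B.basis i) (B.basis.orthonormal.ne_zero i)
  rwa [B.apply_basis, real_inner_smul_left, real_inner_self_eq_norm_sq, B.basis.orthonormal.1,
    one_pow, mul_one] at h

theorem eventually_norm_sub_lt (hF : ResolventFamily M U K) {x : X} (hx : x ∈ U) {δ : ℝ}
    (hδ : 0 < δ) : ∀ᶠ z in 𝓝 x, z ∈ U ∧ ‖K x - K z‖ < δ := by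
  have hU := hF.isOpen.mem_nhds hx
  have hc := (hF.continuousOn.continuousAt hU).tendsto
  filter_upwards [hU, Metric.tendsto_nhds.1 hc δ hδ] with z hz hz'
  exact ⟨hz, by rwa [norm_sub_rev, ← dist_eq_norm]⟩

/-- The number of eigenvalues above a threshold that avoids the spectrum is locally constant. -/
theorem exists_gap_eventually (hF : ResolventFamily M U K) {x : X} (hx : x ∈ U)
    (B : EigenBasis (K x)) {a : ℝ} (ha : 0 < a) :
    ∃ a' δ, 0 < δ ∧ δ < a' ∧ B.upper a' = B.upper a ∧
      (∀ i, B.val i < a' - δ ∨ a' + δ < B.val i) ∧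
      ∀ᶠ z in 𝓝 x, ∀ B' : EigenBasis (K z), (B'.upper a').ncard = (B.upper a).ncard := by
  obtain ⟨a', δ, hδ, hδa, hup, hgap⟩ := B.exists_gap (hF.isCompactOperator x hx) ha
  refine ⟨a', δ, hδ, hδa, hup, hgap, ?_⟩
  filter_upwards [hF.eventually_norm_sub_lt hx hδ] with z hz B'
  rw [← hup]
  exact EigenBasis.ncard_upper_eq (hF.isCompactOperator x hx) (hF.isCompactOperator z hz.1) hδ hδa
    hgap hz.2

theorem eventually_hasSimpleTop (hF : ResolventFamily M U K) {x : X} (hx : x ∈ U)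
    {B : EigenBasis (K x)} {n : ℕ} (hB : B.HasSimpleTop n) :
    ∀ᶠ z in 𝓝 x, ∀ B' : EigenBasis (K z), B'.HasSimpleTop n := by
  have h : ∀ k ∈ Iic n, ∀ᶠ z in 𝓝 x, ∀ B' : EigenBasis (K z),
      ∃ a, 0 < a ∧ (B'.upper a).ncard = k := by
    intro k hk
    obtain ⟨a, ha, rfl⟩ := hB k hk
    obtain ⟨a', δ, hδ, hδa, -, -, hev⟩ := hF.exists_gap_eventually hx B ha
    filter_upwards [hev] with z hz B'
    exact ⟨a', hδ.trans hδa, hz B'⟩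
  filter_upwards [(eventually_all_finite (finite_Iic n)).2 h] with z hz B' k hk
  exact hz k hk B'

/-- Minimizing, over `U`, the number of eigenvalues counted up to the `(n+1)`-st one yields
either a parameter at which that eigenvalue is simple, or one at which it is multiple and does
not split under any small change of the parameter. -/
theorem exists_hasSimpleTop_or_rigid [CompleteSpace H] (hF : ResolventFamily M U K)
    (hinf : ¬ FiniteDimensional ℝ H) {n : ℕ} {x : X} (hx : x ∈ U) {B₀ : EigenBasis (K x)}
    (h₀ : B₀.HasSimpleTop n) :
    (∃ y ∈ U, ∃ B : EigenBasis (K y), B.HasSimpleTop (n + 1)) ∨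
      ∃ y ∈ U, ∃ (κ₀ : ℝ) (u v : H), 0 < κ₀ ∧ K y u = κ₀ • u ∧ K y v = κ₀ • v ∧
        ‖u‖ = 1 ∧ ‖v‖ = 1 ∧ ⟪u, v⟫ = 0 ∧
        ∃ δ : ℝ, 0 < δ ∧ ∀ᶠ z in 𝓝 y, z ∈ U ∧ ∃ κ : ℝ, ∀ p, ∃ q, K z q = κ • q ∧
          δ * ‖p - q‖ ≤ ‖K z p - κ₀ • p‖ := by
  classical
  let P : ℕ → Prop := fun d => ∃ y ∈ U, ∃ B : EigenBasis (K y), B.HasSimpleTop n ∧ n + 1 ≤ d ∧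
    ∃ a, 0 < a ∧ (B.upper a).ncard = d
  have hP : ∃ d, P d := by
    have hι : Infinite B₀.ι := by
      by_contra hfin
      rw [not_infinite_iff_finite] at hfin
      have := Fintype.ofFinite B₀.ι
      exact hinf (Module.Basis.finiteDimensional_of_finite B₀.basis.toOrthonormalBasis.toBasis)
    obtain ⟨s, hs⟩ := Infinite.exists_subset_card_eq B₀.ι (n + 1)
    have hsne : s.Nonempty := Finset.card_pos.1 (by omega)
    obtain ⟨i, hi, hmin⟩ := Finset.exists_min_image s B₀.val hsne
    refine ⟨_, x, hx, B₀, h₀, ?_, B₀.val i, hF.val_pos hx B₀ i, rfl⟩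
    rw [← hs, ← Set.ncard_coe_finset]
    exact Set.ncard_le_ncard (fun j hj => hmin j hj)
      (B₀.finite_upper (hF.isCompactOperator x hx) (hF.val_pos hx B₀ i))
  obtain ⟨y, hy, B, hB, hnd, a, ha, hda⟩ := Nat.find_spec hP
  have hmin := fun d => Nat.find_min' hP (m := d)
  generalize Nat.find hP = d at hnd hda hmin
  by_cases hd : d = n + 1
  · left
    refine ⟨y, hy, B, fun k hk => ?_⟩
    rcases Nat.le_succ_iff.1 hk with hk | rfl
    · exact hB k hk
    · exact ⟨a, ha, hda.trans hd⟩
  right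
  obtain ⟨b, hb, hbn⟩ := hB n le_rfl
  obtain ⟨a₁, δ₁, hδ₁, hδa₁, hup₁, hgap₁, hev₁⟩ := hF.exists_gap_eventually hy B ha
  obtain ⟨b₁, ε₁, hε₁, hεb₁, hupb, hgapb, hevb⟩ := hF.exists_gap_eventually hy B hb
  rw [hda] at hev₁
  rw [hbn] at hevb
  have ha₁ : 0 < a₁ := hδ₁.trans hδa₁
  -- By minimality of `d`, all eigenvalues in `[a₁, b₁)` coincide for parameters near `y`.
  have hcluster : ∀ z ∈ U, ∀ B' : EigenBasis (K z), B'.HasSimpleTop n →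
      (B'.upper a₁).ncard = d → (B'.upper b₁).ncard = n →
      ∀ i j, i ∈ B'.upper a₁ → i ∉ B'.upper b₁ → j ∈ B'.upper a₁ → j ∉ B'.upper b₁ →
        B'.val j ≤ B'.val i := by
    intro z hz B' hB' hd' hn' i j hia hib hja hjb
    by_contra! hlt
    have hfin : ∀ c, 0 < c → (B'.upper c).Finite := fun c hc =>
      B'.finite_upper (hF.isCompactOperator z hz) hc
    have hj : 0 < B'.val j := hF.val_pos hz B' j
    have h1 : n < (B'.upper (B'.val j)).ncard := by
      rw [← hn']
      refine Set.ncard_lt_ncard ((B'.upper_anti (not_le.1 hjb).le).ssubset_of_mem_notMem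
        (a := j) (le_refl (B'.val j)) hjb) (hfin _ hj)
    have h2 : (B'.upper (B'.val j)).ncard < d := by
      rw [← hd']
      exact Set.ncard_lt_ncard ((B'.upper_anti hja).ssubset_of_mem_notMem
        hia (not_le.2 hlt)) (hfin _ ha₁)
    exact absurd (hmin _ ⟨z, hz, B', hB', h1, B'.val j, hj, rfl⟩) (not_le.2 h2)
  have hfin₁ := B.finite_upper (hF.isCompactOperator y hy) ha₁
  have hy₁ := hev₁.self_of_nhds B
  have hyb := hevb.self_of_nhds B
  -- As `d ≥ n + 2`, the band `[a₁, b₁)` holds two basis vectors, with the same eigenvalue.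
  obtain ⟨i, j, ⟨hia, hib⟩, ⟨hja, hjb⟩, hij⟩ : ∃ i j, i ∈ B.upper a₁ \ B.upper b₁ ∧
      j ∈ B.upper a₁ \ B.upper b₁ ∧ i ≠ j := by
    have h1 : 1 < (B.upper a₁ \ B.upper b₁).ncard := by
      have := Set.ncard_le_ncard_sdiff_add_ncard (B.upper a₁) (B.upper b₁)
        (B.finite_upper (hF.isCompactOperator y hy) (hε₁.trans hεb₁))
      omega
    obtain ⟨i, j, hi, hj, hij⟩ := (Set.one_lt_ncard_iff (hfin₁.subset sdiff_subset)).1 h1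
    exact ⟨i, j, hi, hj, hij⟩
  have hval : B.val i = B.val j := le_antisymm
    (hcluster y hy B hB hy₁ hyb j i hja hjb hia hib)
    (hcluster y hy B hB hy₁ hyb i j hia hib hja hjb)
  refine ⟨y, hy, B.val i, B.basis i, B.basis j, hF.val_pos hy B i, B.apply_basis i,
    hval ▸ B.apply_basis j, B.basis.orthonormal.1 i, B.basis.orthonormal.1 j,
    B.basis.orthonormal.2 hij, min δ₁ ε₁, lt_min hδ₁ hε₁, ?_⟩
  have hlow : a₁ + δ₁ < B.val i := (hgap₁ i).resolve_left fun h => by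
    have : a₁ ≤ B.val i := hia
    linarith
  have hhigh : B.val i < b₁ - ε₁ := (hgapb i).resolve_right fun h => by
    have : B.val i < b₁ := not_le.1 hib
    linarith
  filter_upwards [hF.isOpen.mem_nhds hy, hev₁, hevb, hF.eventually_hasSimpleTop hy hB]
    with z hz hz₁ hzb hzn
  refine ⟨hz, ?_⟩
  obtain ⟨B'⟩ := exists_eigenBasis (hF.isCompactOperator z hz) (hF.isSymmetric z hz)
  obtain ⟨l, hla, hlb⟩ : ∃ l ∈ B'.upper a₁, l ∉ B'.upper b₁ :=
    Set.exists_mem_notMem_of_ncard_lt_ncard (by rw [hz₁, hzb]; omega)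
      (B'.finite_upper (hF.isCompactOperator z hz) (hε₁.trans hεb₁))
  refine ⟨B'.val l, fun p => B'.exists_eigenvector_near (lt_min hδ₁ hε₁) (fun m hm => ?_) p⟩
  by_cases hma : m ∈ B'.upper a₁
  · by_cases hmb : m ∈ B'.upper b₁
    · have : b₁ ≤ B'.val m := hmb
      exact (min_le_right _ _).trans (le_trans (by linarith) (le_abs_self _))
    · exact absurd (le_antisymm
        (hcluster z hz B' (hzn B') (hz₁ B') (hzb B') l m hla hlb hma hmb)
        (hcluster z hz B' (hzn B') (hz₁ B') (hzb B') m l hma hmb hla hlb)) hm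
  · have : B'.val m < a₁ := not_le.1 hma
    exact (min_le_left _ _).trans (le_trans (by linarith) (neg_le_abs _))

/-- If a multiple eigenvalue does not split in the direction `σ`, then the compression of `M σ`
to the eigenspace is scalar. -/
theorem inner_eq_of_rigid (hF : ResolventFamily M U K) {y : X} (hy : y ∈ U) {κ₀ : ℝ} {u v : H}
    (hκ₀ : 0 < κ₀) (hu : K y u = κ₀ • u) (hv : K y v = κ₀ • v) (hu1 : ‖u‖ = 1) (hv1 : ‖v‖ = 1)
    (huv : ⟪u, v⟫ = 0) {δ : ℝ} (hδ : 0 < δ)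
    (hrig : ∀ᶠ z in 𝓝 y, z ∈ U ∧ ∃ κ : ℝ, ∀ p, ∃ q, K z q = κ • q ∧
      δ * ‖p - q‖ ≤ ‖K z p - κ₀ • p‖) (σ : X) :
    ⟪u, M σ v⟫ = 0 ∧ ⟪u, M σ u⟫ = ⟪v, M σ v⟫ := by
  have hz : Tendsto (fun t : ℝ => y + t • σ) (𝓝[≠] 0) (𝓝 y) := by
    have : Continuous (fun t : ℝ => y + t • σ) := by fun_prop
    simpa using (this.tendsto 0).mono_left nhdsWithin_le_nhds
  have hc : ∀ z, ∃ κ : ℝ, ∃ q : H → H, (z ∈ U ∧ ∃ κ : ℝ, ∀ p, ∃ q, K z q = κ • q ∧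
      δ * ‖p - q‖ ≤ ‖K z p - κ₀ • p‖) →
      z ∈ U ∧ ∀ p, K z (q p) = κ • q p ∧ δ * ‖p - q p‖ ≤ ‖K z p - κ₀ • p‖ := by
    intro z
    by_cases h : z ∈ U ∧ ∃ κ : ℝ, ∀ p, ∃ q, K z q = κ • q ∧ δ * ‖p - q‖ ≤ ‖K z p - κ₀ • p‖
    · obtain ⟨hz, κ, hκ⟩ := h
      choose q hq using hκ
      exact ⟨κ, q, fun _ => ⟨hz, hq⟩⟩
    · exact ⟨0, id, fun h' => absurd h' h⟩
  choose κ q hq using hc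
  have hq' : ∀ᶠ z in 𝓝 y, z ∈ U ∧ ∀ p, K z (q z p) = κ z • q z p ∧
      δ * ‖p - q z p‖ ≤ ‖K z p - κ₀ • p‖ := hrig.mono fun z h => hq z h
  have hlim : ∀ p, K y p = κ₀ • p → Tendsto (fun t : ℝ => q (y + t • σ) p) (𝓝[≠] 0) (𝓝 p) := by
    intro p hp
    refine Tendsto.comp (g := fun z => q z p) ?_ hz
    rw [tendsto_iff_norm_sub_tendsto_zero]
    have hK : Tendsto (fun z => δ⁻¹ * ‖K z p - κ₀ • p‖) (𝓝 y) (𝓝 0) := by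
      have h1 : Tendsto (fun z => K z p) (𝓝 y) (𝓝 (K y p)) :=
        ((hF.continuousOn.continuousAt (hF.isOpen.mem_nhds hy)).clm_apply
          continuousAt_const).tendsto
      have h2 := ((h1.sub_const (κ₀ • p)).norm).const_mul δ⁻¹
      simpa [hp] using h2
    refine squeeze_zero' (Eventually.of_forall fun _ => norm_nonneg _) ?_ hK
    filter_upwards [hq'] with z hz
    rw [norm_sub_rev, le_inv_mul_iff₀ hδ]
    exact (hz.2 p).2
  -- Symmetry and the resolvent identity relate the two eigenvalue equations.
  have hid : ∀ᶠ t : ℝ in 𝓝[≠] 0, ∀ p r, K y p = κ₀ • p →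
      (κ (y + t • σ) - κ₀) * ⟪p, q (y + t • σ) r⟫ =
        t * κ₀ * κ (y + t • σ) * ⟪p, M σ (q (y + t • σ) r)⟫ := by
    filter_upwards [hz.eventually hq'] with t ht p r hp
    have h1 := hF.resolvent y hy _ ht.1 (q (y + t • σ) r)
    have h2 : y - (y + t • σ) = -(t • σ) := by abel
    have h3 := hF.isSymmetric y hy p (q (y + t • σ) r)
    have h4 := hF.isSymmetric y hy p (M σ (q (y + t • σ) r))
    simp only [ContinuousLinearMap.coe_coe, hp, real_inner_smul_left] at h3 h4
    rw [h2, (ht.2 r).1] at h1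
    have h5 := congrArg (fun x => ⟪p, x⟫) h1
    simp only [map_neg, map_smul, neg_apply, smul_apply, inner_sub_right, inner_neg_right,
      real_inner_smul_right] at h5
    rw [← h3, ← h4] at h5
    linear_combination -h5
  have huu : Tendsto (fun t : ℝ => ⟪u, q (y + t • σ) u⟫) (𝓝[≠] 0) (𝓝 1) := by
    have := (tendsto_const_nhds (x := u)).inner (𝕜 := ℝ) (hlim u hu)
    rwa [real_inner_self_eq_norm_sq, hu1, one_pow] at this
  have hM : ∀ p r, K y r = κ₀ • r →
      Tendsto (fun t : ℝ => ⟪p, M σ (q (y + t • σ) r)⟫) (𝓝[≠] 0) (𝓝 ⟪p, M σ r⟫) := fun p r hr =>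
    (tendsto_const_nhds (x := p)).inner (((M σ).continuous.tendsto r).comp (hlim r hr))
  have hpos : ∀ᶠ t : ℝ in 𝓝[≠] 0, 0 < ⟪u, q (y + t • σ) u⟫ :=
    huu.eventually (lt_mem_nhds one_pos)
  -- The factor of proportionality between `⟪p, q_t⟫` and `⟪p, M σ q_t⟫`.
  let c : ℝ → ℝ := fun t => (κ (y + t • σ) - κ₀) / (t * κ₀ * κ (y + t • σ))
  have hcid : ∀ᶠ t : ℝ in 𝓝[≠] 0, ∀ p r, K y p = κ₀ • p →
      c t * ⟪p, q (y + t • σ) r⟫ = ⟪p, M σ (q (y + t • σ) r)⟫ := by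
    filter_upwards [hid, hpos, self_mem_nhdsWithin] with t h1 h2 h3 p r hp
    -- A zero eigenvalue would make `q_t` orthogonal to `u`, to which it converges.
    have h4 : κ (y + t • σ) ≠ 0 := by
      intro h0
      have := h1 u u hu
      rw [h0] at this
      have : κ₀ * ⟪u, q (y + t • σ) u⟫ = 0 := by linear_combination -this
      exact (mul_pos hκ₀ h2).ne' this
    have h5 : t * κ₀ * κ (y + t • σ) ≠ 0 := mul_ne_zero (mul_ne_zero h3 hκ₀.ne') h4
    simp only [c]
    rw [div_mul_eq_mul_div, div_eq_iff h5, h1 p r hp]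
    ring
  have hclim : Tendsto c (𝓝[≠] 0) (𝓝 ⟪u, M σ u⟫) := by
    have h1 := (hM u u hu).div huu one_ne_zero
    rw [div_one] at h1
    refine h1.congr' ?_
    filter_upwards [hcid, hpos] with t h2 h3
    rw [Pi.div_apply, ← h2 u u hu, mul_div_assoc, div_self h3.ne', mul_one]
  have hmain : ∀ p r, K y p = κ₀ • p → K y r = κ₀ • r →
      ⟪p, M σ r⟫ = ⟪u, M σ u⟫ * ⟪p, r⟫ := by
    intro p r hp hr
    refine tendsto_nhds_unique (hM p r hr) ?_
    refine (hclim.mul ((tendsto_const_nhds (x := p)).inner (𝕜 := ℝ) (hlim r hr))).congr' ?_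
    filter_upwards [hcid] with t h
    exact h p r hp
  constructor
  · rw [hmain u v hu hv, huv, mul_zero]
  · rw [hmain v v hv hv, real_inner_self_eq_norm_sq, hv1, one_pow, mul_one]

/-- If on no plane the compressions of all the operators `M σ` are scalar, then the next
eigenvalue can be made simple without leaving `U`. -/
theorem exists_hasSimpleTop_succ [CompleteSpace H] (hF : ResolventFamily M U K)
    (hinf : ¬ FiniteDimensional ℝ H)
    (hsep : ∀ u v : H, (∀ σ, ⟪u, M σ v⟫ = 0 ∧ ⟪u, M σ u⟫ = ⟪v, M σ v⟫) → u = 0)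
    {n : ℕ} {x : X} (hx : x ∈ U) {B₀ : EigenBasis (K x)} (h₀ : B₀.HasSimpleTop n) :
    ∃ y ∈ U, ∃ B : EigenBasis (K y), B.HasSimpleTop (n + 1) := by
  rcases hF.exists_hasSimpleTop_or_rigid hinf hx h₀ with h |
    ⟨y, hy, κ₀, u, v, hκ₀, hu, hv, hu1, hv1, huv, δ, hδ, hrig⟩
  · exact h
  · have := hsep u v (hF.inner_eq_of_rigid hy hκ₀ hu hv hu1 hv1 huv hδ hrig)
    simp [this] at hu1

end ResolventFamily

/-! ### The resolvent of a coercive form -/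

section Resolvent

variable [CompleteSpace H] {V : Type*} [NormedAddCommGroup V] [InnerProductSpace ℝ V]
  [CompleteSpace V]

/-- The operator on the form domain `V` that represents, in the inner product of `V`, the form
`⟪p, q⟫ + (s - 1) ⟪J p, J q⟫ - ⟪m (J p), J q⟫`. -/
noncomputable def formOp (J : V →L[ℝ] H) (s : ℝ) (m : H →L[ℝ] H) : V →L[ℝ] V :=
  ContinuousLinearMap.id ℝ V + J†.comp (((s - 1) • ContinuousLinearMap.id ℝ H - m).comp J)

/-- The resolvent on `H` of the form represented by `formOp J s m`. -/
noncomputable def formResolvent (J : V →L[ℝ] H) (s : ℝ) (m : H →L[ℝ] H) : H →L[ℝ] H :=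
  J.comp ((Ring.inverse (formOp J s m)).comp (J†))

variable {J : V →L[ℝ] H} {s : ℝ} {m m' : H →L[ℝ] H}

theorem formOp_apply (p : V) : formOp J s m p = p + (J†) ((s - 1) • J p - m (J p)) := rfl

theorem inner_formOp (p q : V) :
    ⟪formOp J s m p, q⟫ = ⟪p, q⟫ + (s - 1) * ⟪J p, J q⟫ - ⟪m (J p), J q⟫ := by
  rw [formOp_apply, inner_add_left, adjoint_inner_left, inner_sub_left, real_inner_smul_left]
  ring

theorem norm_sq_le_inner_formOp (hm : ‖m‖ ≤ s - 1) (p : V) : ‖p‖ ^ 2 ≤ ⟪formOp J s m p, p⟫ := by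
  rw [inner_formOp, real_inner_self_eq_norm_sq, real_inner_self_eq_norm_sq]
  have h : ⟪m (J p), J p⟫ ≤ ‖m‖ * ‖J p‖ ^ 2 := by
    calc _ ≤ ‖m (J p)‖ * ‖J p‖ := real_inner_le_norm _ _
      _ ≤ ‖m‖ * ‖J p‖ * ‖J p‖ := by gcongr; exact m.le_opNorm _
      _ = _ := by ring
  nlinarith [sq_nonneg ‖J p‖]

theorem isUnit_formOp (hm : ‖m‖ ≤ s - 1) : IsUnit (formOp J s m) := by
  refine isUnit_of_forall_le_norm_inner_map _ one_pos fun p => ?_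
  rw [NNReal.coe_one, mul_one]
  exact (norm_sq_le_inner_formOp hm p).trans (le_abs_self _)

theorem formOp_inverse_apply (hm : ‖m‖ ≤ s - 1) (p : V) :
    formOp J s m (Ring.inverse (formOp J s m) p) = p :=
  congrArg (fun T : V →L[ℝ] V => T p) (Ring.mul_inverse_cancel _ (isUnit_formOp hm))

theorem inverse_formOp_apply (hm : ‖m‖ ≤ s - 1) (p : V) :
    Ring.inverse (formOp J s m) (formOp J s m p) = p :=
  congrArg (fun T : V →L[ℝ] V => T p) (Ring.inverse_mul_cancel _ (isUnit_formOp hm))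

theorem inner_formOp_comm (hs : (m : H →ₗ[ℝ] H).IsSymmetric) (p q : V) :
    ⟪formOp J s m p, q⟫ = ⟪p, formOp J s m q⟫ := by
  have h : ⟪m (J p), J q⟫ = ⟪J p, m (J q)⟫ := hs (J p) (J q)
  rw [real_inner_comm (formOp J s m q) p, inner_formOp, inner_formOp, h, real_inner_comm q p,
    real_inner_comm (J q) (J p), real_inner_comm (m (J q)) (J p)]

theorem isSymmetric_formResolvent (hm : ‖m‖ ≤ s - 1) (hs : (m : H →ₗ[ℝ] H).IsSymmetric) :
    (formResolvent J s m : H →ₗ[ℝ] H).IsSymmetric := by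
  intro f g
  change ⟪J (Ring.inverse (formOp J s m) ((J†) f)), g⟫ =
    ⟪f, J (Ring.inverse (formOp J s m) ((J†) g))⟫
  rw [← adjoint_inner_right J, ← adjoint_inner_left J _ f]
  have h := inner_formOp_comm (J := J) (s := s) hs (Ring.inverse (formOp J s m) ((J†) f))
    (Ring.inverse (formOp J s m) ((J†) g))
  rw [formOp_inverse_apply hm, formOp_inverse_apply hm] at h
  exact h.symm

theorem isCompactOperator_formResolvent (hJ : IsCompactOperator J) :
    IsCompactOperator (formResolvent J s m) :=
  hJ.comp_clm ((Ring.inverse (formOp J s m)).comp (J†))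

theorem inner_formResolvent_pos (hm : ‖m‖ ≤ s - 1) (hJ : ∀ f, (J†) f = 0 → f = 0) {f : H}
    (hf : f ≠ 0) : 0 < ⟪formResolvent J s m f, f⟫ := by
  change 0 < ⟪J (Ring.inverse (formOp J s m) ((J†) f)), f⟫
  set p := Ring.inverse (formOp J s m) ((J†) f) with hp
  have h1 : formOp J s m p = (J†) f := formOp_inverse_apply hm _
  have hp0 : p ≠ 0 := by
    intro h0
    rw [h0, map_zero] at h1
    exact hf (hJ f h1.symm)
  rw [← adjoint_inner_right, ← h1, real_inner_comm]
  exact (by positivity : 0 < ‖p‖ ^ 2).trans_le (norm_sq_le_inner_formOp hm p)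

/-- The resolvent identity. -/
theorem formResolvent_sub (hm : ‖m‖ ≤ s - 1) (hm' : ‖m'‖ ≤ s - 1) (f : H) :
    formResolvent J s m f - formResolvent J s m' f =
      formResolvent J s m ((m - m') (formResolvent J s m' f)) := by
  change J (Ring.inverse (formOp J s m) ((J†) f)) - J (Ring.inverse (formOp J s m') ((J†) f)) =
    J (Ring.inverse (formOp J s m) ((J†) ((m - m') (J (Ring.inverse (formOp J s m') ((J†) f))))))
  set p := Ring.inverse (formOp J s m) ((J†) f) with hp
  set q := Ring.inverse (formOp J s m') ((J†) f) with hq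
  have h1 : formOp J s m p = (J†) f := formOp_inverse_apply hm _
  have h2 : formOp J s m' q = (J†) f := formOp_inverse_apply hm' _
  have h3 : (J†) ((m - m') (J q)) = formOp J s m (p - q) := by
    rw [map_sub, h1, ← h2, formOp_apply, formOp_apply, sub_apply, map_sub, map_sub, map_sub]
    abel
  rw [h3, inverse_formOp_apply hm, map_sub]

theorem continuousOn_formResolvent :
    ContinuousOn (fun m => formResolvent J s m) {m | ‖m‖ ≤ s - 1} := by
  intro m hm
  have h1 : ContinuousAt (fun m => formOp J s m) m := by
    unfold formOp
    fun_prop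
  obtain ⟨T, hT⟩ := isUnit_formOp (J := J) hm
  have h2 : ContinuousAt (fun m => Ring.inverse (formOp J s m)) m := by
    refine ContinuousAt.comp (g := Ring.inverse) ?_ h1
    rw [← hT]
    exact NormedRing.inverse_continuousAt T
  refine ContinuousAt.continuousWithinAt ?_
  exact continuousAt_const.clm_comp (h2.clm_comp continuousAt_const)

/-- The weak eigenvalue equation on the form domain is an eigenvalue equation for the resolvent. -/
theorem exists_adjoint_eq_iff (hm : ‖m‖ ≤ s - 1) (μ : ℝ) (u : H) :
    (∃ p, J p = u ∧ p = (J†) (m u + (μ + 1) • u)) ↔ u = (μ + s) • formResolvent J s m u := by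
  constructor
  · rintro ⟨p, rfl, hp⟩
    have h1 : formOp J s m p = (μ + s) • (J†) (J p) := by
      rw [formOp_apply]
      nth_rewrite 1 [hp]
      rw [← map_add, ← map_smul (J†)]
      congr 1
      module
    have h2 := inverse_formOp_apply (J := J) hm p
    rw [h1, map_smul] at h2
    conv_lhs => rw [← h2, map_smul]
    rfl
  · intro hu
    let q := Ring.inverse (formOp J s m) ((J†) u)
    have h1 : formOp J s m q = (J†) u := formOp_inverse_apply hm _
    have h2 : J ((μ + s) • q) = u := by
      rw [map_smul]
      exact hu.symm
    refine ⟨(μ + s) • q, h2, ?_⟩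
    have h3 : formOp J s m ((μ + s) • q) = (μ + s) • (J†) u := by rw [map_smul, h1]
    rw [formOp_apply, h2] at h3
    rw [eq_sub_of_add_eq h3, ← map_smul, ← map_sub]
    congr 1
    module

theorem resolventFamily_formResolvent (hJ : IsCompactOperator J) (hJ' : ∀ f, (J†) f = 0 → f = 0)
    (M : X →L[ℝ] H →L[ℝ] H) (hMs : ∀ x, (M x : H →ₗ[ℝ] H).IsSymmetric) {U : Set X}
    (hU : IsOpen U) (hMU : ∀ x ∈ U, ‖M x‖ ≤ s - 1) :
    ResolventFamily (M : X →ₗ[ℝ] H →L[ℝ] H) U (fun x => formResolvent J s (M x)) where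
  isOpen := hU
  continuousOn := continuousOn_formResolvent.comp M.continuous.continuousOn hMU
  isSymmetric x hx := isSymmetric_formResolvent (hMU x hx) (hMs x)
  isCompactOperator _ _ := isCompactOperator_formResolvent hJ
  pos x hx _ hu := inner_formResolvent_pos (hMU x hx) hJ' hu
  resolvent x hx y hy f := by
    rw [formResolvent_sub (hMU x hx) (hMU y hy) f, coe_coe, map_sub]

end Resolvent

/-! ### Simple eigenvalues and counting of eigenvalues -/

section Eigenvalues

/- Throughout, `E μ` stands for the eigenspace `ker (𝒜 + ρ + μ)`, and `K` for the resolvent. -/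
variable {K : H →L[ℝ] H} {B : EigenBasis K} {s : ℝ} {E : ℝ → Submodule ℝ H}

theorem EigenBasis.basis_mem (hpos : ∀ i, 0 < B.val i) (hE : ∀ μ u, u ∈ E μ ↔ u = (μ + s) • K u)
    (i : B.ι) : B.basis i ∈ E ((B.val i)⁻¹ - s) := by
  rw [hE, sub_add_cancel, B.apply_basis, smul_smul, inv_mul_cancel₀ (hpos i).ne', one_smul]

theorem EigenBasis.apply_eq_of_mem (hE : ∀ μ u, u ∈ E μ ↔ u = (μ + s) • K u) {μ : ℝ} {u : H}
    (hu : u ∈ E μ) (hu0 : u ≠ 0) : K u = (μ + s)⁻¹ • u := by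
  have h := (hE μ u).1 hu
  have h0 : μ + s ≠ 0 := by
    intro h0
    rw [h0, zero_smul] at h
    exact hu0 h
  rw [eq_inv_smul_iff₀ h0, ← h]

theorem EigenBasis.exists_eq_of_ne_bot (B : EigenBasis K)
    (hE : ∀ μ u, u ∈ E μ ↔ u = (μ + s) • K u) {μ : ℝ} (hμ : E μ ≠ ⊥) :
    ∃ i, (B.val i)⁻¹ - s = μ := by
  obtain ⟨u, hu, hu0⟩ := Submodule.exists_mem_ne_zero_of_ne_bot hμ
  obtain ⟨i, hi⟩ := B.exists_val_eq (apply_eq_of_mem hE hu hu0) hu0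
  exact ⟨i, by rw [hi, inv_inv, add_sub_cancel_right]⟩

/-- If the eigenvalues `ev 0 < ev 1 < …` are the lowest ones and simple, then exactly `k` of the
eigenvalues of `K` are at least that corresponding to `ev (k - 1)`. -/
theorem EigenBasis.hasSimpleTop_of_simple (hpos : ∀ i, 0 < B.val i)
    (hE : ∀ μ u, u ∈ E μ ↔ u = (μ + s) • K u) {n : ℕ} {ev : Fin n → ℝ} (hmono : StrictMono ev)
    (hrank : ∀ i, finrank ℝ (E (ev i)) = 1)
    (hlast : ∀ μ, E μ ≠ ⊥ → μ ∈ range ev ∨ ∀ i, ev i < μ) : B.HasSimpleTop n := by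
  have hne : ∀ i, E (ev i) ≠ ⊥ := by
    intro i h
    have := hrank i
    rw [h, finrank_bot] at this
    exact zero_ne_one this
  choose e he using fun i => B.exists_eq_of_ne_bot hE (hne i)
  have hmem := fun i => B.basis_mem hpos hE i
  have hinj : Function.Injective e := by
    intro i j hij
    exact hmono.injective (by rw [← he i, ← he j, hij])
  intro k hk
  rcases k with _ | k
  · refine ⟨‖K‖ + 1, by positivity, ?_⟩
    have hempty : B.upper (‖K‖ + 1) = ∅ := by
      refine eq_empty_of_forall_notMem fun i hi => ?_
      have h1 : ‖K‖ + 1 ≤ B.val i := hi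
      have h2 := K.le_opNorm (B.basis i)
      rw [B.apply_basis, norm_smul, B.basis.orthonormal.1, mul_one, mul_one] at h2
      linarith [Real.le_norm_self (B.val i)]
    rw [hempty, Set.ncard_empty]
  · let k' : Fin n := ⟨k, hk⟩
    refine ⟨B.val (e k'), hpos _, ?_⟩
    have hset : B.upper (B.val (e k')) = e '' Iic k' := by
      ext j
      have hle : ∀ i, B.val (e k') ≤ B.val i ↔ (B.val i)⁻¹ - s ≤ ev k' := by
        intro i
        rw [← he k', sub_le_sub_iff_right, inv_le_inv₀ (hpos _) (hpos _)]
      simp only [EigenBasis.upper, mem_ofPred_eq, hle, mem_image, mem_Iic]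
      constructor
      · intro hj
        have hj0 : E ((B.val j)⁻¹ - s) ≠ ⊥ := fun h => by
          have := hmem j
          rw [h, Submodule.mem_bot] at this
          exact B.basis.orthonormal.ne_zero j this
        rcases hlast _ hj0 with ⟨i, hi⟩ | h
        · refine ⟨i, hmono.le_iff_le.1 (hi.le.trans hj), ?_⟩
          by_contra hij
          obtain ⟨v, hv0, hv⟩ := finrank_eq_one_iff'.1 (hrank i)
          obtain ⟨c, hc⟩ := hv ⟨B.basis (e i), he i ▸ hmem (e i)⟩
          obtain ⟨d, hd⟩ := hv ⟨B.basis j, hi ▸ hmem j⟩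
          have hc' : c • (v : H) = B.basis (e i) := congrArg Subtype.val hc
          have hd' : d • (v : H) = B.basis j := congrArg Subtype.val hd
          have h0 : ⟪B.basis (e i), B.basis j⟫ = 0 := B.basis.orthonormal.2 hij
          rw [← hc', ← hd', real_inner_smul_left, real_inner_smul_right] at h0
          have hc0 : c ≠ 0 := by
            rintro rfl
            rw [zero_smul] at hc'
            exact B.basis.orthonormal.ne_zero _ hc'.symm
          have hd0 : d ≠ 0 := by
            rintro rfl
            rw [zero_smul] at hd'
            exact B.basis.orthonormal.ne_zero _ hd'.symm
          have : ⟪(v : H), v⟫ = 0 := by simpa [hc0, hd0] using h0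
          exact hv0 (Subtype.ext (inner_self_eq_zero.1 this))
        · exact absurd (h k') (not_lt.2 hj)
      · rintro ⟨i, hi, rfl⟩
        rw [he]
        exact hmono.monotone hi
    rw [hset, Set.ncard_image_of_injective _ hinj, ← Finset.coe_Iic, Set.ncard_coe_finset,
      Fin.card_Iic]

/-- Conversely, between the thresholds with `k` and with `k + 1` eigenvalues above them there is
exactly one eigenvalue of `K`, and it is simple. -/
theorem EigenBasis.HasSimpleTop.exists_simple (hpos : ∀ i, 0 < B.val i)
    (hfin : ∀ a, 0 < a → (B.upper a).Finite) (hE : ∀ μ u, u ∈ E μ ↔ u = (μ + s) • K u) {n : ℕ}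
    (hB : B.HasSimpleTop n) :
    ∃ ev : Fin n → ℝ, StrictMono ev ∧ (∀ i, finrank ℝ (E (ev i)) = 1) ∧
      ∀ μ, E μ ≠ ⊥ → μ ∈ range ev ∨ ∀ i, ev i < μ := by
  choose a ha hcard using hB
  have hanti : ∀ k l (hk : k ≤ n) (hl : l ≤ n), k < l → a l hl < a k hk := by
    intro k l hk hl hkl
    by_contra! h
    have := Set.ncard_le_ncard (B.upper_anti h) (hfin _ (ha k hk))
    rw [hcard, hcard] at this
    omega
  have hex : ∀ k : Fin n, ∃ i, B.upper (a ((k : ℕ) + 1) k.2) \ B.upper (a k k.2.le) = {i} := by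
    intro k
    rw [← Set.ncard_eq_one, Set.ncard_sdiff (B.upper_anti (hanti _ _ _ _ (Nat.lt_succ_self _)).le)
      (hfin _ (ha _ _)), hcard, hcard]
    omega
  choose e he using hex
  have hmem : ∀ k : Fin n, e k ∈ B.upper (a ((k : ℕ) + 1) k.2) \ B.upper (a k k.2.le) := fun k => by
    rw [he]; exact mem_singleton _
  have hlow : ∀ k : Fin n, a ((k : ℕ) + 1) k.2 ≤ B.val (e k) := fun k => (hmem k).1
  have hhigh : ∀ k : Fin n, B.val (e k) < a k k.2.le := fun k => not_le.1 (hmem k).2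
  have hval : ∀ k l : Fin n, k < l → B.val (e l) < B.val (e k) := by
    intro k l hkl
    refine (hhigh l).trans_le (le_trans ?_ (hlow k))
    rcases (Nat.succ_le_of_lt hkl).eq_or_lt with h | h
    · exact le_of_eq (by congr 1; exact h.symm)
    · exact (hanti _ _ _ _ h).le
  have hmono : StrictMono fun k => (B.val (e k))⁻¹ - s := by
    intro k l hkl
    exact sub_lt_sub_right ((inv_lt_inv₀ (hpos _) (hpos _)).2 (hval k l hkl)) s
  have hinj : Function.Injective e := by
    intro k l hkl
    exact hmono.injective (by simp only [hkl])
  have hsimple : ∀ k j, B.val j = B.val (e k) → j = e k := by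
    intro k j hj
    have : j ∈ B.upper (a ((k : ℕ) + 1) k.2) \ B.upper (a k k.2.le) := by
      refine ⟨(hlow k).trans hj.ge, fun h => ?_⟩
      have h' : a k k.2.le ≤ B.val j := h
      exact absurd (hj ▸ h') (not_le.2 (hhigh k))
    rw [he] at this
    exact this
  refine ⟨_, hmono, fun k => ?_, fun μ hμ => ?_⟩
  · refine finrank_eq_one_iff'.2 ⟨⟨B.basis (e k), B.basis_mem hpos hE (e k)⟩, ?_, ?_⟩
    · intro h
      exact B.basis.orthonormal.ne_zero _ (congrArg Subtype.val h)
    · rintro ⟨w, hw⟩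
      refine ⟨⟪B.basis (e k), w⟫, Subtype.ext ?_⟩
      change ⟪B.basis (e k), w⟫ • B.basis (e k) = w
      by_cases hw0 : w = 0
      · simp [hw0]
      have hKw := EigenBasis.apply_eq_of_mem hE hw hw0
      rw [sub_add_cancel, inv_inv] at hKw
      rw [eq_comm, ← sub_eq_zero, ← norm_eq_zero, ← sq_eq_zero_iff]
      refine (B.hasSum_sq _).unique ?_
      convert! hasSum_zero using 2 with j
      rw [sq_eq_zero_iff, inner_sub_right, real_inner_smul_right]
      by_cases hj : j = e k
      · rw [hj, real_inner_self_eq_norm_sq, B.basis.orthonormal.1]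
        ring
      · rw [B.inner_basis_eq_zero hKw fun h => hj (hsimple k j h), B.basis.orthonormal.2 hj]
        ring
  · obtain ⟨j, rfl⟩ := B.exists_eq_of_ne_bot hE hμ
    by_cases hj : j ∈ B.upper (a n le_rfl)
    · left
      have hsub : range e ⊆ B.upper (a n le_rfl) := by
        rintro _ ⟨k, rfl⟩
        refine le_trans ?_ (hlow k)
        rcases (Nat.succ_le_of_lt k.2).eq_or_lt with h | h
        · exact le_of_eq (by congr 1; exact h.symm)
        · exact (hanti _ _ _ _ h).le
      have heq := Set.eq_of_subset_of_ncard_le hsub (by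
        rw [hcard, ← image_univ, Set.ncard_image_of_injective _ hinj, Set.ncard_univ,
          Nat.card_eq_fintype_card, Fintype.card_fin]) (hfin _ (ha _ _))
      rw [← heq] at hj
      obtain ⟨k, rfl⟩ := hj
      exact ⟨k, rfl⟩
    · right
      intro k
      refine sub_lt_sub_right ((inv_lt_inv₀ (hpos _) (hpos _)).2 ?_) s
      refine (not_le.1 hj).trans_le (le_trans ?_ (hlow k))
      rcases (Nat.succ_le_of_lt k.2).eq_or_lt with h | h
      · exact le_of_eq (by congr 1; exact h.symm)
      · exact (hanti _ _ _ _ h).le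

end Eigenvalues

/-! ### Multiplication operators on `L²(Ω)` -/

variable {N : ℕ} {Ω : Opens (Euc N)} {w : Euc N → ℝ}

/-- Multiplication of `L²` functions by `L^∞` functions. -/
noncomputable def mulOp (Ω : Opens (Euc N)) : LInf Ω →L[ℝ] L2 Ω →L[ℝ] L2 Ω :=
  LinearMap.mkContinuous₂
    (LinearMap.mk₂ ℝ (fun (ρ : LInf Ω) (u : L2 Ω) => (ρ • u : L2 Ω))
      (fun ρ ρ' u => Lp.smul_add ρ ρ' u) (fun c ρ u => Lp.smul_assoc c ρ u)
      (fun ρ u v => Lp.add_smul ρ u v) (fun c ρ u => (Lp.smul_comm c ρ u).symm))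
    1 (fun ρ u => by
      rw [one_mul]
      exact Lp.norm_smul_le ρ u)

theorem mulOp_apply (ρ : LInf Ω) (u : L2 Ω) : mulOp Ω ρ u = ρ • u := rfl

theorem norm_mulOp_le (ρ : LInf Ω) : ‖mulOp Ω ρ‖ ≤ ‖ρ‖ :=
  ContinuousLinearMap.opNorm_le_bound _ (norm_nonneg _) fun u => Lp.norm_smul_le ρ u

theorem inner_mulOp (ρ : LInf Ω) (u v : L2 Ω) :
    ⟪u, mulOp Ω ρ v⟫ = ∫ x, ρ x * (u x * v x) ∂(dom Ω) := by
  rw [L2.inner_def]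
  refine integral_congr_ae ?_
  filter_upwards [Lp.coeFn_lpSMul (r := 2) ρ v] with x hx
  rw [mulOp_apply, hx]
  simp only [Pi.smul_apply', smul_eq_mul, RCLike.inner_apply, conj_trivial]
  ring

theorem isSymmetric_mulOp (ρ : LInf Ω) : (mulOp Ω ρ : L2 Ω →ₗ[ℝ] L2 Ω).IsSymmetric := by
  intro u v
  change ⟪mulOp Ω ρ u, v⟫ = ⟪u, mulOp Ω ρ v⟫
  rw [real_inner_comm, inner_mulOp, inner_mulOp]
  simp only [mul_comm]

theorem isFiniteMeasure_dom (hΩ : Bornology.IsBounded (Ω : Set (Euc N))) :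
    IsFiniteMeasure (dom Ω) :=
  ⟨by rw [Measure.restrict_apply_univ]; exact hΩ.measure_lt_top⟩

/-- No two-dimensional eigenspace is rigid: testing with indicator functions `σ`, the hypothesis
gives `u v = 0` and `u² = v²` almost everywhere. -/
theorem eq_zero_of_forall_inner_mulOp [IsFiniteMeasure (dom Ω)] (u v : L2 Ω)
    (h : ∀ σ : LInf Ω, ⟪u, mulOp Ω σ v⟫ = 0 ∧ ⟪u, mulOp Ω σ u⟫ = ⟪v, mulOp Ω σ v⟫) : u = 0 := by
  have hint : ∀ f g : L2 Ω, Integrable (fun x => f x * g x) (dom Ω) := fun f g =>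
    (Lp.memLp f).integrable_mul (Lp.memLp g)
  have hind : ∀ (s : Set (Euc N)) (hs : MeasurableSet s) (f g : L2 Ω),
      ⟪f, mulOp Ω (indicatorConstLp ∞ hs (measure_ne_top (dom Ω) s) 1) g⟫ =
        ∫ x in s, f x * g x ∂(dom Ω) := by
    intro s hs f g
    rw [inner_mulOp, ← integral_indicator hs]
    refine integral_congr_ae ?_
    filter_upwards [indicatorConstLp_coeFn (p := ∞) (hs := hs)
      (hμs := measure_ne_top (dom Ω) s) (c := (1 : ℝ))] with x hx
    rw [hx]
    by_cases hxs : x ∈ s <;> simp [hxs]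
  have h1 : (fun x => u x * v x) =ᵐ[dom Ω] 0 :=
    (hint u v).ae_eq_zero_of_forall_setIntegral_eq_zero fun s hs _ => by
      rw [← hind s hs, (h _).1]
  have h2 : (fun x => u x * u x - v x * v x) =ᵐ[dom Ω] 0 :=
    ((hint u u).sub (hint v v)).ae_eq_zero_of_forall_setIntegral_eq_zero fun s hs _ => by
      have := integral_sub (hint u u).integrableOn (hint v v).integrableOn (μ := (dom Ω).restrict s)
      refine this.trans ?_
      rw [← hind s hs, ← hind s hs, (h _).2, sub_self]
  refine (Lp.eq_zero_iff_ae_eq_zero).2 ?_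
  filter_upwards [h1, h2] with x hx1 hx2
  simp only [Pi.zero_apply] at hx1 hx2 ⊢
  rcases mul_eq_zero.1 hx1 with h0 | h0
  · exact h0
  · rw [h0, mul_zero, sub_zero] at hx2
    exact mul_self_eq_zero.1 hx2

/-- Indicator functions of infinitely many disjoint open sets are linearly independent. This makes
`𝒜 + ρ` have infinitely many eigenvalues. -/
theorem not_finiteDimensional_L2 (hN : 1 ≤ N) (hne : (Ω : Set (Euc N)).Nonempty)
    [IsFiniteMeasure (dom Ω)] : ¬ FiniteDimensional ℝ (L2 Ω) := by
  have : Nonempty (Fin N) := ⟨⟨0, hN⟩⟩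
  obtain ⟨x, hx⟩ := hne
  have hinf : Infinite (Ω : Set (Euc N)) :=
    (infinite_of_mem_nhds x (Ω.isOpen.mem_nhds hx)).to_subtype
  obtain ⟨U, hUi, hUo, hUd⟩ := exists_seq_infinite_isOpen_pairwise_disjoint (Ω : Set (Euc N))
  let W : ℕ → Set (Euc N) := fun n => Subtype.val '' U n
  have hWo : ∀ n, IsOpen (W n) := fun n => Ω.isOpen.isOpenMap_subtype_val _ (hUo n)
  have hWΩ : ∀ n, W n ⊆ Ω := by
    rintro n _ ⟨y, -, rfl⟩
    exact y.2
  have hWpos : ∀ n, dom Ω (W n) ≠ 0 := by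
    intro n
    rw [Measure.restrict_apply (hWo n).measurableSet, inter_eq_left.2 (hWΩ n)]
    exact ((hWo n).measure_pos _ ((hUi n).nonempty.image _)).ne'
  let f : ℕ → L2 Ω := fun n =>
    indicatorConstLp 2 (hWo n).measurableSet (measure_ne_top (dom Ω) (W n)) (1 : ℝ)
  have hf : LinearIndependent ℝ f := by
    refine linearIndependent_of_ne_zero_of_inner_eq_zero (fun n h0 => ?_) fun m n hmn => ?_
    · have : ‖f n‖ = 0 := by rw [h0, norm_zero]
      rw [norm_indicatorConstLp (by simp) (by simp), norm_one, one_mul] at this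
      have h2 : (dom Ω).real (W n) ≠ 0 :=
        (ENNReal.toReal_pos (hWpos n) (measure_ne_top _ _)).ne'
      have h3 := Real.rpow_pos_of_pos
        (ENNReal.toReal_pos (hWpos n) (measure_ne_top (dom Ω) (W n))) (1 / (2 : ℝ≥0∞).toReal)
      exact h3.ne' this
    · have hd : W m ∩ W n = ∅ :=
        disjoint_iff_inter_eq_empty.1
          ((disjoint_image_iff Subtype.val_injective).2 (hUd hmn))
      change ⟪f m, f n⟫ = 0
      rw [L2.inner_indicatorConstLp_one (𝕜 := ℝ)]
      rw [setIntegral_congr_ae (g := fun _ => (0 : ℝ)) (hWo m).measurableSet, integral_zero]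
      filter_upwards [indicatorConstLp_coeFn (p := 2) (hs := (hWo n).measurableSet)
        (hμs := measure_ne_top (dom Ω) (W n)) (c := (1 : ℝ))] with x hx hxm
      rw [hx, indicator_of_notMem]
      intro hxn
      exact (hd ▸ (⟨hxm, hxn⟩ : x ∈ W m ∩ W n) : x ∈ (∅ : Set (Euc N)))
  intro hfd
  exact (not_finite_iff_infinite.2 (inferInstance : Infinite ℕ)) hf.finite

/-! ### The form domain -/

instance : CompleteSpace (H01 Ω w) :=
  (testPairs Ω w).isClosed_topologicalClosure.completeSpace_coe

/-- The embedding of `H₀¹(Ω; w)` into `L²(Ω)`. -/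
noncomputable def embL2 (Ω : Opens (Euc N)) (w : Euc N → ℝ) : H01 Ω w →L[ℝ] L2 Ω :=
  (WithLp.fstL 2 ℝ (L2 Ω) (Lp (Euc N) 2 (wdom Ω w))).comp (H01 Ω w).subtypeL

theorem embL2_apply (p : H01 Ω w) : embL2 Ω w p = (p : Pairs Ω w).fst := rfl

/-- The eigenspaces in terms of the inner product of the form domain. -/
theorem mem_eigenspace_iff_exists (ρ : LInf Ω) (μ : ℝ) (u : L2 Ω) :
    u ∈ eigenspace Ω w ρ μ ↔
      ∃ p, embL2 Ω w p = u ∧ p = ((embL2 Ω w)†) (mulOp Ω ρ u + (μ + 1) • u) := by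
  have key : ∀ p : H01 Ω w, embL2 Ω w p = u →
      ((∀ q ∈ testPairs Ω w, ⟪(p : Pairs Ω w).snd, q.snd⟫ =
          - ⟪-((ρ • u : L2 Ω) + μ • u), q.fst⟫) ↔
        p = ((embL2 Ω w)†) (mulOp Ω ρ u + (μ + 1) • u)) := by
    intro p hp
    have hinner : ∀ q : Pairs Ω w, (⟪(p : Pairs Ω w).snd, q.snd⟫ =
        - ⟪-((ρ • u : L2 Ω) + μ • u), q.fst⟫) ↔
          ⟪(p : Pairs Ω w), q⟫ = ⟪mulOp Ω ρ u + (μ + 1) • u, q.fst⟫ := by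
      intro q
      have hsplit : ⟪(p : Pairs Ω w), q⟫ = ⟪u, q.fst⟫ + ⟪(p : Pairs Ω w).snd, q.snd⟫ := by
        rw [← hp]
        rfl
      rw [hsplit, mulOp_apply]
      simp only [inner_neg_left, neg_neg, inner_add_left, real_inner_smul_left]
      constructor <;> intro h <;> linear_combination h
    constructor
    · intro h
      refine ext_inner_right ℝ fun q => ?_
      rw [adjoint_inner_left, embL2_apply]
      have hcl : IsClosed {q : Pairs Ω w | ⟪(p : Pairs Ω w), q⟫ =
          ⟪mulOp Ω ρ u + (μ + 1) • u, q.fst⟫} := by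
        refine isClosed_eq (by fun_prop) ?_
        exact continuous_const.inner
          (WithLp.fstL 2 ℝ (L2 Ω) (Lp (Euc N) 2 (wdom Ω w))).continuous
      exact closure_minimal (fun q hq => (hinner q).1 (h q hq)) hcl q.2
    · intro h q hq
      rw [hinner]
      have h1 := adjoint_inner_left (embL2 Ω w)
        (⟨q, (testPairs Ω w).le_topologicalClosure hq⟩ : H01 Ω w) (mulOp Ω ρ u + (μ + 1) • u)
      rw [← h] at h1
      exact h1
  constructor
  · rintro ⟨p, hp, hpu, h⟩
    exact ⟨⟨p, hp⟩, hpu, (key ⟨p, hp⟩ hpu).1 h⟩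
  · rintro ⟨p, hpu, h⟩
    exact ⟨p, p.2, hpu, (key p hpu).2 h⟩

/-- Test functions have finite norm in `H¹(Ω; w)`, the weighted measure of `Ω` being finite. -/
theorem exists_testPair (hΩ : Bornology.IsBounded (Ω : Set (Euc N)))
    (hw : LocallyIntegrable w volume) (φ : 𝓓(Ω, ℝ)) :
    ∃ q ∈ testPairs Ω w, q.fst =ᵐ[dom Ω] φ := by
  have := isFiniteMeasure_dom hΩ
  have hwi : IntegrableOn w Ω :=
    (hw.integrableOn_isCompact hΩ.isCompact_closure).mono_set subset_closure
  have : IsFiniteMeasure (wdom Ω w) :=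
    isFiniteMeasure_withDensity_ofReal hwi.2
  have h1 : MemLp φ 2 (dom Ω) := by
    exact φ.continuous.memLp_of_hasCompactSupport φ.hasCompactSupport
  have hcont : Continuous (∇ φ) :=
    (InnerProductSpace.toDual ℝ (Euc N)).symm.continuous.comp
      (φ.contDiff.continuous_fderiv (by simp))
  have hsupp : HasCompactSupport (∇ φ) := by
    exact (φ.hasCompactSupport.fderiv (𝕜 := ℝ)).comp_left (map_zero _)
  have h2 : MemLp (∇ φ) 2 (wdom Ω w) := hcont.memLp_of_hasCompactSupport hsupp
  exact ⟨WithLp.toLp 2 (h1.toLp, h2.toLp), ⟨φ, h1.coeFn_toLp, h2.coeFn_toLp⟩, h1.coeFn_toLp⟩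

/-- The adjoint of the embedding is injective, because test functions are dense in `L²(Ω)`. -/
theorem eq_zero_of_adjoint_embL2 (hΩ : Bornology.IsBounded (Ω : Set (Euc N)))
    (hw : LocallyIntegrable w volume) (f : L2 Ω) (hf : ((embL2 Ω w)†) f = 0) : f = 0 := by
  have := isFiniteMeasure_dom hΩ
  have hfi : IntegrableOn f Ω := (Lp.memLp f).integrable (by norm_num)
  have h := Ω.isOpen.ae_eq_zero_of_integral_contDiff_smul_eq_zero
    hfi.locallyIntegrableOn fun g hg hgc hgs => by
      let φ : 𝓓(Ω, ℝ) := ⟨g, hg, hgc, hgs⟩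
      obtain ⟨q, hq, hqφ⟩ := exists_testPair hΩ hw φ
      have h1 := adjoint_inner_left (embL2 Ω w)
        (⟨q, (testPairs Ω w).le_topologicalClosure hq⟩ : H01 Ω w) f
      rw [hf, inner_zero_left, embL2_apply, L2.inner_def] at h1
      rw [← setIntegral_eq_integral_of_forall_compl_eq_zero (s := (Ω : Set (Euc N)))]
      · refine (integral_congr_ae ?_).trans h1.symm
        filter_upwards [hqφ] with x hx
        simp only [RCLike.inner_apply, conj_trivial, hx]
        rfl
      · intro x hx
        rw [image_eq_zero_of_notMem_tsupport fun h => hx (hgs h), zero_smul]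
  refine Lp.eq_zero_iff_ae_eq_zero.2 ?_
  exact (ae_restrict_iff' Ω.isOpen.measurableSet).2 h

/-! ### Simplicity of eigenvalues -/

section

variable {Γ : Set (Euc N)}

/-- For `ρ` with `‖ρ‖ ≤ s - 1`, the operators `(s - 𝒜 - ρ)⁻¹` form a family of resolvents; the
shift by `s` makes the form coercive. -/
theorem Admissible.resolventFamily (hw : Admissible Ω Γ w) {s : ℝ} {U : Set (LInf Ω)}
    (hU : IsOpen U) (hUs : ∀ ρ ∈ U, ‖ρ‖ ≤ s - 1) :
    ResolventFamily (mulOp Ω : LInf Ω →ₗ[ℝ] L2 Ω →L[ℝ] L2 Ω) U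
      (fun ρ => formResolvent (embL2 Ω w) s (mulOp Ω ρ)) :=
  resolventFamily_formResolvent hw.compact
    (eq_zero_of_adjoint_embL2 hw.isBounded hw.isA2Weight.locallyIntegrable) _ isSymmetric_mulOp hU
    fun ρ hρ => (norm_mulOp_le ρ).trans (hUs ρ hρ)

/-- `A_n` in terms of counts of eigenvalues of the resolvent. -/
theorem Admissible.mem_simpleSet_iff (hw : Admissible Ω Γ w) {s : ℝ} {ρ : LInf Ω}
    (hρ : ‖ρ‖ < s - 1) (B : EigenBasis (formResolvent (embL2 Ω w) s (mulOp Ω ρ))) (n : ℕ) :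
    ρ ∈ simpleSet Ω w n ↔ B.HasSimpleTop n := by
  have hF := hw.resolventFamily (s := s) (U := Metric.ball 0 (s - 1)) Metric.isOpen_ball
    fun σ hσ => (mem_ball_zero_iff.1 hσ).le
  have hρ' : ρ ∈ Metric.ball (0 : LInf Ω) (s - 1) := mem_ball_zero_iff.2 hρ
  have hE : ∀ μ u, u ∈ eigenspace Ω w ρ μ ↔
      u = (μ + s) • formResolvent (embL2 Ω w) s (mulOp Ω ρ) u := fun μ u => by
    rw [mem_eigenspace_iff_exists, exists_adjoint_eq_iff ((norm_mulOp_le ρ).trans hρ.le)]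
  have hpos := hF.val_pos hρ' B
  constructor
  · rintro ⟨ev, hmono, hrank, hlast⟩
    exact B.hasSimpleTop_of_simple hpos hE hmono hrank hlast
  · intro hB
    exact hB.exists_simple hpos (fun a ha => B.finite_upper (hF.isCompactOperator ρ hρ') ha) hE

theorem Admissible.exists_eigenBasis (hw : Admissible Ω Γ w) {s : ℝ} {ρ : LInf Ω}
    (hρ : ‖ρ‖ < s - 1) : Nonempty (EigenBasis (formResolvent (embL2 Ω w) s (mulOp Ω ρ))) :=
  DegenerateElliptic.exists_eigenBasis (isCompactOperator_formResolvent hw.compact)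
    (isSymmetric_formResolvent ((norm_mulOp_le ρ).trans hρ.le) (isSymmetric_mulOp ρ))

theorem Admissible.simpleSet_anti (hw : Admissible Ω Γ w) {m n : ℕ} (hmn : m ≤ n) :
    simpleSet Ω w n ⊆ simpleSet Ω w m := by
  intro ρ hρ
  have hs : ‖ρ‖ < ‖ρ‖ + 2 - 1 := by linarith
  obtain ⟨B⟩ := hw.exists_eigenBasis hs
  rw [hw.mem_simpleSet_iff hs B] at hρ ⊢
  exact fun k hk => hρ k (hk.trans hmn)

theorem Admissible.simpleSet_subset_closure (hN : 1 ≤ N) (hw : Admissible Ω Γ w) (n : ℕ) :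
    simpleSet Ω w n ⊆ closure (simpleSet Ω w (n + 1)) := by
  intro ρ hρ
  have := isFiniteMeasure_dom hw.isBounded
  rw [Metric.mem_closure_iff]
  intro ε hε
  have hlt : ∀ σ ∈ Metric.ball ρ (min ε 1), ‖σ‖ < ‖ρ‖ + 2 - 1 := by
    intro σ hσ
    have h1 : ‖σ - ρ‖ < 1 := by
      rw [← dist_eq_norm]
      exact (Metric.mem_ball.1 hσ).trans_le (min_le_right _ _)
    linarith [norm_le_norm_add_norm_sub' σ ρ]
  have hρU : ρ ∈ Metric.ball ρ (min ε 1) := Metric.mem_ball_self (lt_min hε one_pos)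
  obtain ⟨B⟩ := hw.exists_eigenBasis (hlt ρ hρU)
  obtain ⟨σ, hσ, B', hB'⟩ := (hw.resolventFamily (s := ‖ρ‖ + 2) Metric.isOpen_ball
    fun σ hσ => (hlt σ hσ).le).exists_hasSimpleTop_succ
      (not_finiteDimensional_L2 hN hw.isConnected.nonempty) eq_zero_of_forall_inner_mulOp hρU
      ((hw.mem_simpleSet_iff (hlt ρ hρU) B n).1 hρ)
  refine ⟨σ, (hw.mem_simpleSet_iff (hlt σ hσ) B' (n + 1)).2 hB', ?_⟩
  rw [dist_comm]
  exact (Metric.mem_ball.1 hσ).trans_le (min_le_left _ _)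

end

end DegenerateElliptic

open DegenerateElliptic in
theorem theorem4p2 {N : ℕ} (hN : 1 ≤ N) (Ω : Opens (Euc N)) (Γ : Set (Euc N)) (w : Euc N → ℝ)
    (hw : Admissible Ω Γ w) :
    simpleSet Ω w 0 = univ ∧
      ∀ n : ℕ, 1 ≤ n →
        simpleSet Ω w n ⊆ simpleSet Ω w (n - 1) ∧
        simpleSet Ω w (n - 1) ⊆ closure (simpleSet Ω w n) := by
  refine ⟨eq_univ_of_forall fun ρ => ⟨Fin.elim0, fun i => i.elim0, fun i => i.elim0,
    fun μ _ => Or.inr fun i => i.elim0⟩, fun n hn => ⟨hw.simpleSet_anti (Nat.sub_le n 1), ?_⟩⟩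
  have h := hw.simpleSet_subset_closure hN (n - 1)
  rwa [Nat.sub_add_cancel hn] at h
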